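/- Let $M$ be a smooth $n$-dimensional manifold (without boundary, Hausdorff, second countable), let $\alpha,\beta\in\mathbb R$, let $I\subseteq\mathbb R$ be an open interval, and let $g(t)$, $t\in I$, be an $(\alpha,\beta)$-Ricci-Yamabe flow on $M$: a family of Riemannian metrics, smooth in $(t,x)\in I\times M$, with $$\partial_t g=-2\alpha\,\mathrm{Ric}-\beta R\,g ,$$ where $\mathrm{Ric}=(R_{ij})$ and $R$ are the Ricci tensor and the scalar curvature of $g(t)$. Let $\nabla$, $\Delta_{g(t)}$, $\Gamma^k_{ij}$ and $d\mu(t)$ denote the Levi-Civita connection, the Laplacian, the Christoffel symbols and the volume form of $g(t)$; when $n=2$ let $K$ be the Gaussian curvature. Then, for every $t\in I$: 1. In every smooth chart, $$\partial_t\Gamma^k_{ij}=\alpha\, g^{kl}\left(\nabla_lR_{ij}-\nabla_iR_{jl}-\nabla_jR_{il}\right)-\frac{\beta}{2}\left[(\nabla_iR)\,\delta^k_j+(\nabla_jR)\,\delta^k_i-(\nabla^kR)\,g_{ij}\right].$$ 2. The scalar curvature satisfies $$\partial_tR=[\alpha+(n-1)\beta]\,\Delta_{g(t)}R+2\alpha\,\|\mathrm{Ric}\|^2_{g(t)}+\beta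 R^2 ;$$ for $n=2$ moreover $$\partial_tR=(\alpha+\beta)\left[\Delta_{g(t)}R+R^2\right],\qquad \partial_tK=(\alpha+\beta)\left[\Delta_{g(t)}K+2K^2\right].$$ 3. The volume form $d\mu=\sqrt{\det(g_{ij})}\,dx^1\cdots dx^n$ satisfies $$\partial_t\,d\mu(t)=-\left(\alpha+\frac n2\beta\right)R(t)\,d\mu(t).$$ Hence, if $2\alpha+n\beta=0$, the Riemannian volume measure of $g(t)$ (in particular the total volume of $M$) is independent of $t\in I$; in this case, if $\alpha\neq0$, $$\frac1\alpha\,\partial_tR=\frac{2-n}{n}\,\Delta_{g(t)}R+2\,\|\mathrm{Ric}\|^2_{g(t)}-\frac2n R^2 ,$$ and if $n=2$, then $\partial_tR=0$. 4. If $n=2$, $M$ is compact, $\alpha+\beta\ge1$ and $(0,T]\subseteq I$, then for all $t\in(0,T]$, everywhere on $M$, $$K(t)\ge-\frac{1}{2(\alpha+\beta)t}.$$ -/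

import Mathlib

open scoped Manifold ContDiff

namespace RicciYamabe

/-! ## Tensor calculus in local coordinates

A Riemannian metric in local coordinates is a matrix-valued function `G y = (g_ij(y))` on (an open
subset of) `ℝⁿ`. All objects below are the classical coordinate expressions. -/

/-- The coordinate space `ℝⁿ`. -/
abbrev Coord (n : ℕ) : Type := EuclideanSpace ℝ (Fin n)

/-- The partial derivative `∂_k f` at `y`. -/
noncomputable def pd {n : ℕ} (f : Coord n → ℝ) (k : Fin n) (y : Coord n) : ℝ :=
  fderiv ℝ f y (EuclideanSpace.single k 1)

/-- The Christoffel symbol `Γ^k_ij = ½ g^{kl} (∂_i g_jl + ∂_j g_il - ∂_l g_ij)`. -/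
noncomputable def christoffel {n : ℕ} (G : Coord n → Matrix (Fin n) (Fin n) ℝ)
    (k i j : Fin n) (y : Coord n) : ℝ :=
  (1 / 2) * ∑ l, (G y)⁻¹ k l *
    (pd (fun z => G z j l) i y + pd (fun z => G z i l) j y - pd (fun z => G z i j) l y)

/-- The components `R^l_{ijk}` of the Riemann curvature tensor, with the convention
`∇_i ∇_j ∂_k - ∇_j ∇_i ∂_k = R^l_{ijk} ∂_l`, that is
`R^l_{ijk} = ∂_i Γ^l_jk - ∂_j Γ^l_ik + Γ^m_jk Γ^l_im - Γ^m_ik Γ^l_jm`. -/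
noncomputable def riemann {n : ℕ} (G : Coord n → Matrix (Fin n) (Fin n) ℝ)
    (l i j k : Fin n) (y : Coord n) : ℝ :=
  pd (christoffel G l j k) i y - pd (christoffel G l i k) j y
    + ∑ m, (christoffel G m j k y * christoffel G l i m y
      - christoffel G m i k y * christoffel G l j m y)

/-- The Ricci tensor `R_jk = R^l_{ljk}` (positive on round spheres). -/
noncomputable def ricci {n : ℕ} (G : Coord n → Matrix (Fin n) (Fin n) ℝ)
    (j k : Fin n) (y : Coord n) : ℝ :=
  ∑ l, riemann G l l j k y

/-- The scalar curvature `R = g^{ij} R_ij`. -/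
noncomputable def scalarCurv {n : ℕ} (G : Coord n → Matrix (Fin n) (Fin n) ℝ)
    (y : Coord n) : ℝ :=
  ∑ i, ∑ j, (G y)⁻¹ i j * ricci G i j y

/-- The sectional curvature of the plane spanned by `∂_i`, `∂_j`, namely
`g(Rm(∂_i, ∂_j) ∂_j, ∂_i) / (g_ii g_jj - g_ij²)`. -/
noncomputable def sectionalCurv {n : ℕ} (G : Coord n → Matrix (Fin n) (Fin n) ℝ)
    (i j : Fin n) (y : Coord n) : ℝ :=
  (∑ m, G y i m * riemann G m i j j y) / (G y i i * G y j j - G y i j ^ 2)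

/-- The Gaussian curvature of a surface. -/
noncomputable def gaussCurv {n : ℕ} (hn : n = 2) (G : Coord n → Matrix (Fin n) (Fin n) ℝ)
    (y : Coord n) : ℝ :=
  sectionalCurv G ⟨0, by omega⟩ ⟨1, by omega⟩ y

/-- The covariant derivative `∇_l T_ij = ∂_l T_ij - Γ^m_li T_mj - Γ^m_lj T_im` of a
`(0,2)`-tensor field. -/
noncomputable def covDeriv {n : ℕ} (G : Coord n → Matrix (Fin n) (Fin n) ℝ)
    (T : Fin n → Fin n → Coord n → ℝ) (l i j : Fin n) (y : Coord n) : ℝ :=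
  pd (T i j) l y
    - ∑ m, (christoffel G m l i y * T m j y + christoffel G m l j y * T i m y)

/-- The gradient components `∇^k f = g^{kl} ∂_l f`. -/
noncomputable def gradUp {n : ℕ} (G : Coord n → Matrix (Fin n) (Fin n) ℝ)
    (f : Coord n → ℝ) (k : Fin n) (y : Coord n) : ℝ :=
  ∑ l, (G y)⁻¹ k l * pd f l y

/-- The Laplacian `Δf = g^{ij} (∂_i ∂_j f - Γ^k_ij ∂_k f)`. -/
noncomputable def laplacian {n : ℕ} (G : Coord n → Matrix (Fin n) (Fin n) ℝ)
    (f : Coord n → ℝ) (y : Coord n) : ℝ :=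
  ∑ i, ∑ j, (G y)⁻¹ i j * (pd (pd f j) i y - ∑ k, christoffel G k i j y * pd f k y)

/-- The squared norm `‖Ric‖² = g^{ik} g^{jl} R_ij R_kl`. -/
noncomputable def ricciNormSq {n : ℕ} (G : Coord n → Matrix (Fin n) (Fin n) ℝ)
    (y : Coord n) : ℝ :=
  ∑ i, ∑ j, ∑ k, ∑ l,
    (G y)⁻¹ i k * (G y)⁻¹ j l * ricci G i j y * ricci G k l y

/-- The density of the Riemannian volume form `dμ = √(det g_ij) dx¹ ⋯ dxⁿ`. -/
noncomputable def volDensity {n : ℕ} (G : Coord n → Matrix (Fin n) (Fin n) ℝ)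
    (y : Coord n) : ℝ :=
  Real.sqrt (G y).det

/-! ## Manifolds -/

/-- Smooth Riemannian metrics on a smooth `n`-dimensional manifold `M`. -/
abbrev Metric (n : ℕ) (M : Type*) [TopologicalSpace M] [ChartedSpace (Coord n) M]
    [IsManifold (𝓡 n) ∞ M] :=
  haveI : IsManifold (𝓡 n) 1 M := IsManifold.of_le (n := ∞) (by simp)
  Bundle.ContMDiffRiemannianMetric (𝓡 n) ∞ (Coord n) (fun x : M => TangentSpace (𝓡 n) x)

/-- The smooth charts of `M`: all local coordinate systems of the smooth structure. -/
abbrev charts (n : ℕ) (M : Type*) [TopologicalSpace M] [ChartedSpace (Coord n) M] :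
    Set (OpenPartialHomeomorph M (Coord n)) :=
  IsManifold.maximalAtlas (𝓡 n) ∞ M

/-- The coordinate vector field `∂_i` of the chart `φ`, at the point with coordinates `y`. -/
noncomputable def coordVec {n : ℕ} {M : Type*} [TopologicalSpace M] [ChartedSpace (Coord n) M]
    (φ : OpenPartialHomeomorph M (Coord n)) (i : Fin n) (y : Coord n) :
    TangentSpace (𝓡 n) (φ.symm y) :=
  mfderiv (𝓡 n) (𝓡 n) φ.symm y (EuclideanSpace.single i (1 : ℝ) : Coord n)

/-- The components `g_ij = g(∂_i, ∂_j)` of the metric `g` in the chart `φ`, as functions of the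
coordinates. -/
noncomputable def coeff {n : ℕ} {M : Type*} [TopologicalSpace M] [ChartedSpace (Coord n) M]
    [IsManifold (𝓡 n) ∞ M] (g : Metric n M) (φ : OpenPartialHomeomorph M (Coord n))
    (y : Coord n) : Matrix (Fin n) (Fin n) ℝ :=
  Matrix.of fun i j => g.inner (φ.symm y) (coordVec φ i y) (coordVec φ j y)

/-- The measure `√(det g_ij) dx¹ ⋯ dxⁿ` on the domain of the chart `φ`, as a measure on `M`. -/
noncomputable def chartVolume {n : ℕ} {M : Type*} [TopologicalSpace M]
    [ChartedSpace (Coord n) M] [IsManifold (𝓡 n) ∞ M] [MeasurableSpace M] (g : Metric n M)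
    (φ : OpenPartialHomeomorph M (Coord n)) : MeasureTheory.Measure M :=
  ((MeasureTheory.volume.restrict φ.target).withDensity
    fun y => ENNReal.ofReal (volDensity (coeff g φ) y)).map φ.symm

/-- The Riemannian volume measure of `g`: the least measure which dominates
`√(det g_ij) dx¹ ⋯ dxⁿ` on every chart domain. As these measures agree on the intersections of
chart domains, on a second countable manifold it is the measure obtained by gluing them. -/
noncomputable def volumeMeasure {n : ℕ} {M : Type*} [TopologicalSpace M]
    [ChartedSpace (Coord n) M] [IsManifold (𝓡 n) ∞ M] [MeasurableSpace M] (g : Metric n M) :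
    MeasureTheory.Measure M :=
  ⨆ φ ∈ charts n M, chartVolume g φ

/-- The time-dependent metric `g` is a Riemannian flow on the time set `I`: it is smooth in space
and time, that is, its components in every chart are smooth functions of `(t, y)`. Only the
values of `g` at times in `I` matter. -/
def IsRiemannianFlow {n : ℕ} {M : Type*} [TopologicalSpace M] [ChartedSpace (Coord n) M]
    [IsManifold (𝓡 n) ∞ M] (I : Set ℝ) (g : ℝ → Metric n M) : Prop :=
  ∀ φ ∈ charts n M, ∀ i j : Fin n,
    ContDiffOn ℝ ∞ (fun p : ℝ × Coord n => coeff (g p.1) φ p.2 i j) (I ×ˢ φ.target)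

/-- The components of the `(α, β)`-Ricci-Yamabe map `∂_t g + 2 α Ric + β R g` in the chart `φ`. -/
noncomputable def ricciYamabeMap {n : ℕ} {M : Type*} [TopologicalSpace M]
    [ChartedSpace (Coord n) M] [IsManifold (𝓡 n) ∞ M] (α β : ℝ) (g : ℝ → Metric n M) (t : ℝ)
    (φ : OpenPartialHomeomorph M (Coord n)) (i j : Fin n) (y : Coord n) : ℝ :=
  deriv (fun s => coeff (g s) φ y i j) t + 2 * α * ricci (coeff (g t) φ) i j y
    + β * scalarCurv (coeff (g t) φ) y * coeff (g t) φ y i j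

/-- `g` is an `(α, β)`-Ricci-Yamabe flow on `I`: a Riemannian flow whose `(α, β)`-Ricci-Yamabe map
vanishes identically. -/
def IsRicciYamabeFlow {n : ℕ} {M : Type*} [TopologicalSpace M] [ChartedSpace (Coord n) M]
    [IsManifold (𝓡 n) ∞ M] (α β : ℝ) (I : Set ℝ) (g : ℝ → Metric n M) : Prop :=
  IsRiemannianFlow I g ∧
    ∀ t ∈ I, ∀ φ ∈ charts n M, ∀ y ∈ φ.target, ∀ i j : Fin n,
      ricciYamabeMap α β g t φ i j y = 0

end RicciYamabe

open RicciYamabe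

namespace RicciYamabe

open scoped Matrix

/-! The evolution equations are identities between polynomials in the metric, its inverse and their
derivatives. The smooth functions on an open set of space-time form a commutative real algebra with
commuting derivations `d i` and a time derivation `D` commuting with them. The tensor calculus is
done in that setting (`MetricAlgebra`), where differentiability never has to be checked; evaluation
at a point is a ring homomorphism that carries the result to the coordinate expressions.

With h = ∂ₜg, differentiating the lowered Christoffel symbols gives 2 g(∂ₜΓ) = ∇h + ∇h − ∇h, and h =
−2α Ric − βRg yields part 1 (`D_chr`). The Palatini identity `D_scal` writes ∂ₜR as (∂ₜg⁻¹)·Ric plus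
the divergence of two traces of ∂ₜΓ. The contracted second Bianchi identity and metric compatibility
make both traces multiples of ∇R, so the divergence is [α + (n−1)β]ΔR, while (∂ₜg⁻¹)·Ric is 2α‖Ric‖²
+ βR². The volume form follows from Jacobi's formula. On a surface the lowered curvature has one
independent component, whence ‖Ric‖² = R²/2 and R = 2K.

The lower bound is a minimum principle for (t − ε)R on the compact set [ε, t] × M, followed by ε →
0. It needs R as a function on M. Chart independence is read off from the flow: the determinants of
the metric in two charts differ by a factor constant in time, and their logarithmic derivatives are
−(2α + nβ)R. -/

theorem map_derivation_mul {ι A : Type*} [Fintype ι] [CommRing A] [Algebra ℝ A]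
    (D : Derivation ℝ A A) (M N : Matrix ι ι A) :
    (M * N).map D = M.map D * N + M * N.map D := by
  ext i j
  simp only [Matrix.map_apply, Matrix.mul_apply, Matrix.add_apply, map_sum, Derivation.leibniz,
    smul_eq_mul, ← Finset.sum_add_distrib]
  exact Finset.sum_congr rfl fun k _ => by ring

theorem map_derivation_add {ι A : Type*} [CommRing A] [Algebra ℝ A]
    (D : Derivation ℝ A A) (M N : Matrix ι ι A) :
    (M + N).map D = M.map D + N.map D := by ext; simp

theorem map_derivation_sub {ι A : Type*} [CommRing A] [Algebra ℝ A]
    (D : Derivation ℝ A A) (M N : Matrix ι ι A) :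
    (M - N).map D = M.map D - N.map D := by ext; simp

/-- A metric with its inverse, over a commutative algebra with commuting partial derivatives. -/
structure MetricAlgebra (ι A : Type*) [Fintype ι] [DecidableEq ι] [CommRing A] [Algebra ℝ A] where
  d : ι → Derivation ℝ A A
  d_comm : ∀ i j a, d i (d j a) = d j (d i a)
  g : Matrix ι ι A
  H : Matrix ι ι A
  g_symm : ∀ i j, g i j = g j i
  g_mul_H : g * H = 1

/-! ### Formal Riemannian geometry over a commutative algebra with derivations -/

namespace MetricAlgebra

variable {ι A : Type*} [Fintype ι] [DecidableEq ι] [CommRing A] [Algebra ℝ A]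

/-- The constant `1/2`. -/
noncomputable def half (A : Type*) [CommRing A] [Algebra ℝ A] : A := algebraMap ℝ A (1 / 2)

theorem two_mul_half : 2 * half A = 1 := by
  have : (2 : A) = algebraMap ℝ A 2 := (map_ofNat _ 2).symm
  rw [half, this, ← map_mul]; norm_num

theorem eq_of_two_mul {x y : A} (h : 2 * x = 2 * y) : x = y := by
  have := two_mul_half (A := A)
  linear_combination half A * h - (x - y) * this

variable (m : MetricAlgebra ι A)

theorem H_mul_g : m.H * m.g = 1 := mul_eq_one_comm.mp m.g_mul_H

theorem g_transpose : m.gᵀ = m.g := by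
  ext i j; exact m.g_symm j i

theorem H_transpose : m.Hᵀ = m.H := by
  have h : m.Hᵀ * m.g = 1 := by
    rw [← m.g_transpose, ← Matrix.transpose_mul, m.g_mul_H, Matrix.transpose_one]
  calc m.Hᵀ = m.Hᵀ * (m.g * m.H) := by rw [m.g_mul_H, mul_one]
    _ = m.H := by rw [← mul_assoc, h, one_mul]

theorem H_symm (i j : ι) : m.H i j = m.H j i := congrFun (congrFun m.H_transpose j) i

/-- Christoffel symbols. -/
noncomputable def chr (k i j : ι) : A :=
  half A * ∑ l, m.H k l * (m.d i (m.g j l) + m.d j (m.g i l) - m.d l (m.g i j))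

/-- Curvature tensor. -/
noncomputable def riem (l i j k : ι) : A :=
  m.d i (m.chr l j k) - m.d j (m.chr l i k)
    + ∑ p, (m.chr p j k * m.chr l i p - m.chr p i k * m.chr l j p)

/-- Ricci tensor. -/
noncomputable def ric (j k : ι) : A := ∑ l, m.riem l l j k

/-- Scalar curvature. -/
noncomputable def scal : A := ∑ i, ∑ j, m.H i j * m.ric i j

/-- Covariant derivative of a `(0,2)`-tensor. -/
noncomputable def cov (T : ι → ι → A) (l i j : ι) : A :=
  m.d l (T i j) - ∑ p, (m.chr p l i * T p j + m.chr p l j * T i p)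

/-- Gradient. -/
noncomputable def grad (f : A) (k : ι) : A := ∑ l, m.H k l * m.d l f

/-- Laplacian. -/
noncomputable def lap (f : A) : A :=
  ∑ i, ∑ j, m.H i j * (m.d i (m.d j f) - ∑ k, m.chr k i j * m.d k f)

/-- Squared norm of the Ricci tensor. -/
noncomputable def normSq : A :=
  ∑ i, ∑ j, ∑ k, ∑ l, m.H i k * m.H j l * m.ric i j * m.ric k l

/-- Divergence of a vector field. -/
noncomputable def div (V : ι → A) : A := ∑ l, m.d l (V l) + ∑ l, ∑ p, m.chr p p l * V l

/-- The connection matrices. -/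
noncomputable def conn (i : ι) : Matrix ι ι A := Matrix.of fun k p => m.chr k i p

/-- The curvature matrices. -/
noncomputable def curv (i j : ι) : Matrix ι ι A := Matrix.of fun l k => m.riem l i j k

theorem sum_g_H (X : ι → A) (p : ι) : ∑ k, m.g p k * ∑ l, m.H k l * X l = X p := by
  have := congrFun (Matrix.mulVec_mulVec X m.g m.H) p
  rw [m.g_mul_H, Matrix.one_mulVec] at this
  exact this

theorem sum_H_g (X : ι → A) (p : ι) : ∑ k, m.H p k * ∑ l, m.g k l * X l = X p := by
  have := congrFun (Matrix.mulVec_mulVec X m.H m.g) p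
  rw [m.H_mul_g, Matrix.one_mulVec] at this
  exact this

/-- Since `g` is invertible, vector fields may be compared after lowering the index, where the
Christoffel symbols have no inverse metric in them. -/
theorem ext_of_sum_g {X Y : ι → A} (h : ∀ p, ∑ k, m.g p k * X k = ∑ k, m.g p k * Y k) (k : ι) :
    X k = Y k := by
  rw [← m.sum_H_g X k, ← m.sum_H_g Y k]
  simp only [h]

theorem chr_symm (k i j : ι) : m.chr k i j = m.chr k j i := by
  unfold chr
  refine congrArg _ (Finset.sum_congr rfl fun l _ => ?_)
  rw [m.g_symm i j]; ring

theorem sum_g_chr (p i j : ι) :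
    2 * ∑ k, m.g p k * m.chr k i j = m.d i (m.g j p) + m.d j (m.g i p) - m.d p (m.g i j) := by
  have h : ∑ k, m.g p k * m.chr k i j = half A *
      (m.d i (m.g j p) + m.d j (m.g i p) - m.d p (m.g i j)) := by
    rw [← m.sum_g_H (fun l => m.d i (m.g j l) + m.d j (m.g i l) - m.d l (m.g i j)) p,
      Finset.mul_sum]
    exact Finset.sum_congr rfl fun k _ => by rw [chr]; ring
  rw [h, ← mul_assoc, two_mul_half, one_mul]

/-- Metric compatibility, ∇g = 0: in the sum of the two lowered Christoffel symbols all terms cancel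
in pairs except two copies of ∂ᵢgⱼₖ. -/
theorem d_g (i j k : ι) :
    m.d i (m.g j k) = ∑ p, m.chr p i j * m.g p k + ∑ p, m.g j p * m.chr p i k := by
  apply eq_of_two_mul
  have h1 := m.sum_g_chr k i j
  have h2 := m.sum_g_chr j i k
  have h3 : ∑ p, m.chr p i j * m.g p k = ∑ p, m.g k p * m.chr p i j :=
    Finset.sum_congr rfl fun p _ => by rw [m.g_symm k p]; ring
  rw [h3, mul_add, h1, h2, m.g_symm k j]; ring

theorem map_d_g (i : ι) : m.g.map (m.d i) = (m.conn i)ᵀ * m.g + m.g * m.conn i := by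
  ext j k
  simp [Matrix.mul_apply, conn, m.d_g i j k]

theorem map_derivation_H (D : Derivation ℝ A A) : m.H.map D = -(m.H * m.g.map D * m.H) := by
  have h := map_derivation_mul D m.g m.H
  rw [m.g_mul_H] at h
  have h1 : (1 : Matrix ι ι A).map D = 0 := by
    ext i j; by_cases hij : i = j <;> simp [hij]
  rw [h1] at h
  have h2 : m.H * (m.g * m.H.map D) = m.H.map D := by
    rw [← mul_assoc, m.H_mul_g, one_mul]
  rw [← h2, eq_neg_iff_add_eq_zero, mul_assoc, ← mul_add, add_comm, ← h, mul_zero]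

theorem map_d_H (i : ι) : m.H.map (m.d i) = -(m.conn i * m.H + m.H * (m.conn i)ᵀ) := by
  rw [map_derivation_H, map_d_g, mul_add, add_mul]
  have h1 : m.H * ((m.conn i)ᵀ * m.g) * m.H = m.H * (m.conn i)ᵀ := by
    rw [mul_assoc, mul_assoc, m.g_mul_H, mul_one]
  have h2 : m.H * (m.g * m.conn i) * m.H = m.conn i * m.H := by
    rw [← mul_assoc, m.H_mul_g, one_mul]
  rw [h1, h2, add_comm]

theorem d_H (i j k : ι) : m.d i (m.H j k) =
    -(∑ p, m.chr j i p * m.H p k + ∑ p, m.H j p * m.chr k i p) := by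
  have := congrFun (congrFun (m.map_d_H i) j) k
  simpa [Matrix.mul_apply, conn, add_comm] using this

/-! ### Curvature symmetries and the second Bianchi identity -/

/-- Curvature as dA + A ∧ A for the connection matrices A, so that its symmetries become identities
in a noncommutative matrix ring. -/
theorem curv_eq (i j : ι) : m.curv i j = (m.conn j).map (m.d i) - (m.conn i).map (m.d j)
    + m.conn i * m.conn j - m.conn j * m.conn i := by
  ext l k
  simp only [curv, riem, conn, Matrix.of_apply, Matrix.sub_apply, Matrix.add_apply,
    Matrix.map_apply, Matrix.mul_apply, Finset.sum_sub_distrib, mul_comm (m.chr _ _ k)]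
  ring

theorem map_d_comm (i j : ι) (M : Matrix ι ι A) :
    (M.map (m.d i)).map (m.d j) = (M.map (m.d j)).map (m.d i) := by
  ext k l; exact m.d_comm _ _ _

theorem curv_swap (i j : ι) : m.curv j i = -m.curv i j := by
  rw [curv_eq, curv_eq]; abel

/-- Expanding ∂ᵢ∂ⱼg = ∂ⱼ∂ᵢg by metric compatibility leaves exactly the antisymmetry of the lowered
curvature in its endomorphism indices. -/
theorem g_mul_curv (i j : ι) : m.g * m.curv i j + (m.curv i j)ᵀ * m.g = 0 := by
  have h := m.map_d_comm i j m.g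
  simp only [map_d_g, map_derivation_add, map_derivation_mul, Matrix.transpose_map] at h
  rw [curv_eq]
  simp only [Matrix.transpose_sub, Matrix.transpose_add, Matrix.transpose_mul, mul_add, add_mul,
    mul_sub, sub_mul] at h ⊢
  simp only [mul_assoc] at h ⊢
  rw [← sub_eq_zero] at h
  rw [← neg_eq_zero, ← h]
  abel

/-- The covariant derivative of the curvature tensor. -/
noncomputable def dcurv (i j k : ι) : Matrix ι ι A :=
  (m.curv j k).map (m.d i) + m.conn i * m.curv j k - m.curv j k * m.conn i
    - ∑ p, (m.chr p i j • m.curv p k + m.chr p i k • m.curv j p)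

/-- The antisymmetry survives covariant differentiation because ∇g = 0: differentiate `g_mul_curv`
and subtract it multiplied by the connection matrix on either side. -/
theorem g_mul_dcurv (i j k : ι) : m.g * m.dcurv i j k + (m.dcurv i j k)ᵀ * m.g = 0 := by
  have h := congrArg (fun M => M.map (m.d i)) (m.g_mul_curv j k)
  have h0 : (0 : Matrix ι ι A).map (m.d i) = 0 := by ext; simp
  simp only [map_derivation_add, map_derivation_mul, map_d_g, Matrix.transpose_map, h0] at h
  have hs : m.g * (∑ p, (m.chr p i j • m.curv p k + m.chr p i k • m.curv j p))
      + (∑ p, (m.chr p i j • m.curv p k + m.chr p i k • m.curv j p))ᵀ * m.g = 0 := by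
    rw [Matrix.transpose_sum, Finset.mul_sum, Finset.sum_mul, ← Finset.sum_add_distrib]
    refine Finset.sum_eq_zero fun p _ => ?_
    have e1 := m.g_mul_curv p k
    have e2 := m.g_mul_curv j p
    simp only [Matrix.transpose_add, Matrix.transpose_smul, mul_add, add_mul, Matrix.mul_smul,
      Matrix.smul_mul]
    calc _ = m.chr p i j • (m.g * m.curv p k + (m.curv p k)ᵀ * m.g)
        + m.chr p i k • (m.g * m.curv j p + (m.curv j p)ᵀ * m.g) := by
          simp only [smul_add]; abel
      _ = 0 := by rw [e1, e2]; simp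
  have e1 : (m.conn i)ᵀ * (m.g * m.curv j k + (m.curv j k)ᵀ * m.g) = 0 := by
    rw [g_mul_curv, mul_zero]
  have e2 : (m.g * m.curv j k + (m.curv j k)ᵀ * m.g) * m.conn i = 0 := by
    rw [g_mul_curv, zero_mul]
  unfold dcurv
  simp only [Matrix.transpose_sub, Matrix.transpose_add, Matrix.transpose_mul, mul_add, add_mul,
    mul_sub, sub_mul, mul_assoc] at h hs e1 e2 ⊢
  have := congrArg₂ (· - ·) (congrArg₂ (· - ·) (congrArg₂ (· - ·) h e1) e2) hs
  simp only [sub_zero] at this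
  rw [← this]
  abel

/-- The second Bianchi identity. -/
theorem bianchi (i j k : ι) : m.dcurv i j k + m.dcurv j k i + m.dcurv k i j = 0 := by
  -- The Christoffel corrections on the form indices cancel cyclically, as Γ is symmetric and the
  -- curvature antisymmetric there.
  have hs : ∑ p, (m.chr p i j • m.curv p k + m.chr p i k • m.curv j p)
      + ∑ p, (m.chr p j k • m.curv p i + m.chr p j i • m.curv k p)
      + ∑ p, (m.chr p k i • m.curv p j + m.chr p k j • m.curv i p) = 0 := by
    rw [← Finset.sum_add_distrib, ← Finset.sum_add_distrib]
    refine Finset.sum_eq_zero fun p _ => ?_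
    rw [m.chr_symm p j i, m.chr_symm p k i, m.chr_symm p k j, m.curv_swap p k, m.curv_swap p j,
      m.curv_swap p i]
    simp only [smul_neg]
    abel
  have hF : ∀ i j k : ι, (m.curv j k).map (m.d i) + m.conn i * m.curv j k - m.curv j k * m.conn i
      = ((m.conn k).map (m.d j)).map (m.d i) - ((m.conn j).map (m.d k)).map (m.d i)
      + ((m.conn j).map (m.d i) * m.conn k + m.conn j * (m.conn k).map (m.d i))
      - ((m.conn k).map (m.d i) * m.conn j + m.conn k * (m.conn j).map (m.d i))
      + m.conn i * ((m.conn k).map (m.d j) - (m.conn j).map (m.d k)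
        + m.conn j * m.conn k - m.conn k * m.conn j)
      - ((m.conn k).map (m.d j) - (m.conn j).map (m.d k)
        + m.conn j * m.conn k - m.conn k * m.conn j) * m.conn i := by
    intro i j k
    rw [curv_eq]
    simp only [map_derivation_add, map_derivation_sub, map_derivation_mul]
  -- What remains is dF + [A, F] = 0 for F = dA + A ∧ A, which only uses that derivatives commute.
  have hG : ((m.curv j k).map (m.d i) + m.conn i * m.curv j k - m.curv j k * m.conn i)
      + ((m.curv k i).map (m.d j) + m.conn j * m.curv k i - m.curv k i * m.conn j)
      + ((m.curv i j).map (m.d k) + m.conn k * m.curv i j - m.curv i j * m.conn k) = 0 := by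
    rw [hF, hF, hF, m.map_d_comm k i, m.map_d_comm j i, m.map_d_comm k j]
    noncomm_ring
  unfold dcurv
  calc _ = ((m.curv j k).map (m.d i) + m.conn i * m.curv j k - m.curv j k * m.conn i)
      + ((m.curv k i).map (m.d j) + m.conn j * m.curv k i - m.curv k i * m.conn j)
      + ((m.curv i j).map (m.d k) + m.conn k * m.curv i j - m.curv i j * m.conn k)
      - (∑ p, (m.chr p i j • m.curv p k + m.chr p i k • m.curv j p)
      + ∑ p, (m.chr p j k • m.curv p i + m.chr p j i • m.curv k p)
      + ∑ p, (m.chr p k i • m.curv p j + m.chr p k j • m.curv i p)) := by abel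
    _ = _ := by rw [hG, hs, sub_zero]

end MetricAlgebra
-- Traces: Ricci symmetry, contracted Bianchi identity, divergences
namespace MetricAlgebra

variable {ι A : Type*} [Fintype ι] [DecidableEq ι] [CommRing A] [Algebra ℝ A]
  (m : MetricAlgebra ι A)

theorem dcurv_swap (i j k : ι) : m.dcurv i k j = -m.dcurv i j k := by
  have h : ∑ p, (m.chr p i k • m.curv p j + m.chr p i j • m.curv k p)
      = -∑ p, (m.chr p i j • m.curv p k + m.chr p i k • m.curv j p) := by
    rw [← Finset.sum_neg_distrib]
    refine Finset.sum_congr rfl fun p _ => ?_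
    rw [m.curv_swap j p, m.curv_swap p k]
    simp only [smul_neg]; abel
  have h2 : (-m.curv j k).map (m.d i) = -(m.curv j k).map (m.d i) := by ext; simp
  rw [dcurv, h, m.curv_swap j k, h2, dcurv, mul_neg, neg_mul]
  abel

/-- Contraction commutes with ∇: the corrections on the two contracted indices cancel. -/
theorem sum_dcurv (j k q : ι) : ∑ l, m.dcurv j l k l q = m.cov m.ric j k q := by
  have h : ∀ l, m.dcurv j l k l q = m.d j (m.riem l l k q)
      + ∑ p, m.chr l j p * m.riem p l k q - ∑ p, m.chr p j q * m.riem l l k p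
      - ∑ p, m.chr p j l * m.riem l p k q - ∑ p, m.chr p j k * m.riem l l p q := by
    intro l
    simp only [dcurv, Matrix.sub_apply, Matrix.add_apply, Matrix.map_apply, Matrix.mul_apply,
      Matrix.sum_apply, Matrix.smul_apply, curv, conn, Matrix.of_apply, smul_eq_mul,
      Finset.sum_add_distrib, mul_comm (m.riem _ _ _ _)]
    ring
  simp only [h, Finset.sum_sub_distrib, Finset.sum_add_distrib, cov, ric, map_sum, Finset.mul_sum]
  rw [Finset.sum_comm (f := fun l p => m.chr p j l * m.riem l p k q),
    Finset.sum_comm (f := fun l p => m.chr p j q * m.riem l l k p),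
    Finset.sum_comm (f := fun l p => m.chr p j k * m.riem l l p q)]
  ring

theorem dcurv_mul_H (i j k l p : ι) :
    ∑ q, m.dcurv i j k l q * m.H q p = -∑ q, m.H l q * m.dcurv i j k p q := by
  have h : m.dcurv i j k * m.H + m.H * (m.dcurv i j k)ᵀ = 0 := by
    have e := congrArg (fun M => m.H * M * m.H) (m.g_mul_dcurv i j k)
    simp only [mul_add, add_mul, mul_zero, zero_mul] at e
    rwa [← mul_assoc, m.H_mul_g, one_mul, ← mul_assoc, mul_assoc, m.g_mul_H, mul_one] at e
  have := congrFun (congrFun h l) p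
  simp only [Matrix.add_apply, Matrix.mul_apply, Matrix.transpose_apply, Matrix.zero_apply] at this
  exact eq_neg_of_add_eq_zero_left this

/-- The inverse metric is parallel, so the metric trace commutes with ∇. -/
theorem sum_H_cov (T : ι → ι → A) (i : ι) :
    ∑ j, ∑ k, m.H j k * m.cov T i j k = m.d i (∑ j, ∑ k, m.H j k * T j k) := by
  simp only [map_sum, Derivation.leibniz, smul_eq_mul, cov, m.d_H, mul_sub, mul_neg, mul_add,
    Finset.sum_add_distrib, Finset.sum_sub_distrib, Finset.sum_neg_distrib, Finset.mul_sum]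
  have e1 : ∑ x, ∑ y, ∑ z, m.H x y * (m.chr z i x * T z y)
      = ∑ x, ∑ y, ∑ z, T x y * (m.chr x i z * m.H z y) := by
    rw [Finset.sum_congr rfl fun x _ => Finset.sum_comm, Finset.sum_comm]
    refine Finset.sum_congr rfl fun x _ => ?_
    rw [Finset.sum_comm]
    refine Finset.sum_congr rfl fun y _ => Finset.sum_congr rfl fun z _ => by ring
  have e2 : ∑ x, ∑ y, ∑ z, m.H x y * (m.chr z i y * T x z)
      = ∑ x, ∑ y, ∑ z, T x y * (m.H x z * m.chr y i z) := by
    refine Finset.sum_congr rfl fun x _ => ?_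
    rw [Finset.sum_comm]
    refine Finset.sum_congr rfl fun y _ => Finset.sum_congr rfl fun z _ => by ring
  rw [e1, e2]
  ring

/-- Multiplying the antisymmetry relation by `H` and taking the trace gives tr F + tr F = 0. -/
theorem trace_curv (i j : ι) : (m.curv i j).trace = 0 := by
  apply eq_of_two_mul
  have e := congrArg (fun M => (m.H * M).trace) (m.g_mul_curv i j)
  simp only [mul_add, Matrix.trace_add, mul_zero, Matrix.trace_zero] at e
  rw [← mul_assoc, m.H_mul_g, one_mul, ← mul_assoc, Matrix.trace_mul_comm, ← mul_assoc,
    m.g_mul_H, one_mul, Matrix.trace_transpose] at e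
  rw [two_mul, e, mul_zero]

/-- By the symmetry of Γ, the antisymmetric part of Ric reduces to derivatives of the traced
connection, that is, to the trace of the curvature, whose commutator part has trace zero. -/
theorem ric_symm (j k : ι) : m.ric j k = m.ric k j := by
  have h := m.trace_curv j k
  rw [curv_eq, Matrix.trace_sub, Matrix.trace_add, Matrix.trace_mul_comm, add_sub_cancel_right] at h
  simp only [Matrix.trace, Matrix.diag, Matrix.sub_apply, Matrix.map_apply, conn, Matrix.of_apply,
    Finset.sum_sub_distrib] at h
  simp only [ric, riem, Finset.sum_add_distrib, Finset.sum_sub_distrib]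
  have e1 : ∑ x, ∑ y, m.chr y x k * m.chr x j y = ∑ x, ∑ y, m.chr y x j * m.chr x k y := by
    rw [Finset.sum_comm]
    refine Finset.sum_congr rfl fun x _ => Finset.sum_congr rfl fun y _ => ?_
    rw [m.chr_symm x y k, m.chr_symm y j x]; ring
  have e2 : ∀ a b, ∑ x, m.d a (m.chr x x b) = ∑ x, m.d a (m.chr x b x) := fun a b =>
    Finset.sum_congr rfl fun x _ => by rw [m.chr_symm]
  have e3 : ∑ x, m.d x (m.chr x k j) = ∑ x, m.d x (m.chr x j k) :=
    Finset.sum_congr rfl fun x _ => by rw [m.chr_symm]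
  have e4 : ∑ x, ∑ y, m.chr y k j * m.chr x x y = ∑ x, ∑ y, m.chr y j k * m.chr x x y :=
    Finset.sum_congr rfl fun x _ => Finset.sum_congr rfl fun y _ => by rw [m.chr_symm y]
  rw [e1, e2, e2, e3, e4]
  linear_combination -h

theorem cov_symm {T : ι → ι → A} (hT : ∀ i j, T i j = T j i) (l i j : ι) :
    m.cov T l i j = m.cov T l j i := by
  simp only [cov, Finset.sum_add_distrib, hT _ j, hT i _]
  ring

/-- The contracted second Bianchi identity. -/
theorem contracted_bianchi (j : ι) :
    2 * ∑ l, ∑ p, m.H l p * m.cov m.ric l p j = m.d j m.scal := by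
  -- Second Bianchi identity traced over one index pair.
  have hb : ∀ k q, ∑ l, m.dcurv l j k l q - m.cov m.ric j k q + m.cov m.ric k j q = 0 := by
    intro k q
    rw [← sum_dcurv, ← sum_dcurv, ← Finset.sum_sub_distrib, ← Finset.sum_add_distrib]
    refine Finset.sum_eq_zero fun l _ => ?_
    have := congrFun (congrFun (m.bianchi l j k) l) q
    rw [m.dcurv_swap j l k] at this
    simpa [sub_eq_add_neg] using this
  -- Swapping both antisymmetric index pairs of ∇Rm turns the second trace into the divergence of
  -- Ric.
  have h1 : ∑ k, ∑ q, m.H k q * ∑ l, m.dcurv l j k l q = ∑ l, ∑ p, m.H l p * m.cov m.ric l p j := by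
    calc _ = ∑ k, ∑ l, ∑ q, m.dcurv l j k l q * m.H q k := by
          refine Finset.sum_congr rfl fun k _ => ?_
          simp only [Finset.mul_sum]
          rw [Finset.sum_comm]
          refine Finset.sum_congr rfl fun l _ => Finset.sum_congr rfl fun q _ => ?_
          rw [m.H_symm k q, mul_comm]
      _ = ∑ k, ∑ l, ∑ q, m.H l q * m.dcurv l k j k q := by
          refine Finset.sum_congr rfl fun k _ => Finset.sum_congr rfl fun l _ => ?_
          rw [dcurv_mul_H, ← Finset.sum_neg_distrib]
          refine Finset.sum_congr rfl fun q _ => ?_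
          rw [m.dcurv_swap l j k]; simp
      _ = _ := by
          rw [Finset.sum_comm]
          refine Finset.sum_congr rfl fun l _ => ?_
          rw [Finset.sum_comm]
          refine Finset.sum_congr rfl fun q _ => ?_
          rw [← Finset.mul_sum, sum_dcurv, m.cov_symm m.ric_symm]
  have h2 : ∑ k, ∑ q, m.H k q *
      (∑ l, m.dcurv l j k l q - m.cov m.ric j k q + m.cov m.ric k j q) = 0 := by
    simp [hb]
  simp only [mul_add, mul_sub, Finset.sum_add_distrib, Finset.sum_sub_distrib] at h2
  rw [h1, sum_H_cov] at h2
  have h3 : ∑ k, ∑ q, m.H k q * m.cov m.ric k j q = ∑ l, ∑ p, m.H l p * m.cov m.ric l p j :=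
    Finset.sum_congr rfl fun k _ => Finset.sum_congr rfl fun q _ => by
      rw [m.cov_symm m.ric_symm k j q]
  rw [h3] at h2
  change _ - m.d j m.scal + _ = 0 at h2
  linear_combination h2

/-- As ∇H = 0, the divergence of a raised covector is the trace of its covariant derivative; one of
the two terms from `d_H` cancels the trace Γᵖₚₗ in `div`. -/
theorem div_raise (T : ι → A) :
    m.div (fun l => ∑ k, m.H l k * T k)
      = ∑ i, ∑ j, m.H i j * (m.d i (T j) - ∑ k, m.chr k i j * T k) := by
  simp only [div, map_sum, Derivation.leibniz, smul_eq_mul, m.d_H, mul_sub, mul_neg,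
    mul_add, Finset.sum_add_distrib, Finset.sum_sub_distrib, Finset.sum_neg_distrib,
    Finset.mul_sum]
  have e1 : ∑ x, ∑ y, ∑ z, m.H x y * (m.chr z x y * T z)
      = ∑ x, ∑ y, ∑ z, T y * (m.H x z * m.chr y x z) := by
    refine Finset.sum_congr rfl fun x _ => ?_
    rw [Finset.sum_comm]
    refine Finset.sum_congr rfl fun y _ => Finset.sum_congr rfl fun z _ => by ring
  have e2 : ∑ x, ∑ y, ∑ z, m.chr y y x * (m.H x z * T z)
      = ∑ x, ∑ y, ∑ z, T y * (m.chr x x z * m.H z y) := by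
    rw [Finset.sum_comm]
    refine Finset.sum_congr rfl fun x _ => ?_
    rw [Finset.sum_comm]
    refine Finset.sum_congr rfl fun y _ => Finset.sum_congr rfl fun z _ => by ring
  rw [e1, e2]
  ring

theorem lap_eq (f : A) : m.lap f = m.div (m.grad f) :=
  (m.div_raise fun k => m.d k f).symm

/-- The bracket on the right is ∇ₗCˡⱼₖ in coordinates; ∇H = 0 again lets the trace pass through. It
will be applied to the variation of Γ. -/
theorem div_contract (C : ι → ι → ι → A) :
    m.div (fun l => ∑ j, ∑ k, m.H j k * C l j k)
      = ∑ j, ∑ k, m.H j k * (∑ l, m.d l (C l j k) + ∑ l, ∑ p, (C p j k * m.chr l l p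
        - C p l k * m.chr l j p - m.chr p l k * C l j p)) := by
  have e0 : ∑ l, ∑ p, m.chr p p l * ∑ j, ∑ k, m.H j k * C l j k
      = ∑ j, ∑ k, m.H j k * ∑ l, ∑ p, C p j k * m.chr l l p := by
    simp only [Finset.mul_sum]
    calc _ = ∑ l, ∑ j, ∑ p, ∑ k, m.chr p p l * (m.H j k * C l j k) :=
          Finset.sum_congr rfl fun l _ => Finset.sum_comm
      _ = ∑ j, ∑ l, ∑ p, ∑ k, m.chr p p l * (m.H j k * C l j k) := Finset.sum_comm
      _ = ∑ j, ∑ p, ∑ l, ∑ k, m.chr p p l * (m.H j k * C l j k) :=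
          Finset.sum_congr rfl fun l _ => Finset.sum_comm
      _ = ∑ j, ∑ p, ∑ k, ∑ l, m.chr p p l * (m.H j k * C l j k) :=
          Finset.sum_congr rfl fun l _ => Finset.sum_congr rfl fun l _ => Finset.sum_comm
      _ = ∑ j, ∑ k, ∑ p, ∑ l, m.chr p p l * (m.H j k * C l j k) :=
          Finset.sum_congr rfl fun l _ => Finset.sum_comm
      _ = _ := Finset.sum_congr rfl fun _ _ => Finset.sum_congr rfl fun _ _ =>
          Finset.sum_congr rfl fun _ _ => Finset.sum_congr rfl fun _ _ => by ring
  have e1 : ∑ l, ∑ j, ∑ k, m.H j k * m.d l (C l j k)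
      = ∑ j, ∑ k, m.H j k * ∑ l, m.d l (C l j k) := by
    simp only [Finset.mul_sum]
    rw [Finset.sum_comm]
    exact Finset.sum_congr rfl fun _ _ => Finset.sum_comm
  have e2 : ∑ l, ∑ j, ∑ k, C l j k * ∑ p, m.chr j l p * m.H p k
      = ∑ j, ∑ k, m.H j k * ∑ l, ∑ p, C p l k * m.chr l j p := by
    simp only [Finset.mul_sum]
    calc _ = ∑ l, ∑ j, ∑ p, ∑ k, C l j k * (m.chr j l p * m.H p k) :=
          Finset.sum_congr rfl fun l _ => Finset.sum_congr rfl fun l _ => Finset.sum_comm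
      _ = ∑ l, ∑ p, ∑ j, ∑ k, C l j k * (m.chr j l p * m.H p k) :=
          Finset.sum_congr rfl fun l _ => Finset.sum_comm
      _ = ∑ p, ∑ l, ∑ j, ∑ k, C l j k * (m.chr j l p * m.H p k) := Finset.sum_comm
      _ = ∑ p, ∑ l, ∑ k, ∑ j, C l j k * (m.chr j l p * m.H p k) :=
          Finset.sum_congr rfl fun l _ => Finset.sum_congr rfl fun l _ => Finset.sum_comm
      _ = ∑ p, ∑ k, ∑ l, ∑ j, C l j k * (m.chr j l p * m.H p k) :=
          Finset.sum_congr rfl fun l _ => Finset.sum_comm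
      _ = ∑ p, ∑ k, ∑ j, ∑ l, C l j k * (m.chr j l p * m.H p k) :=
          Finset.sum_congr rfl fun l _ => Finset.sum_congr rfl fun l _ => Finset.sum_comm
      _ = _ := Finset.sum_congr rfl fun p _ => Finset.sum_congr rfl fun _ _ =>
          Finset.sum_congr rfl fun j _ => Finset.sum_congr rfl fun l _ => by
            rw [m.chr_symm j l p]; ring
  have e3 : ∑ l, ∑ j, ∑ k, C l j k * ∑ p, m.H j p * m.chr k l p
      = ∑ j, ∑ k, m.H j k * ∑ l, ∑ p, m.chr p l k * C l j p := by
    simp only [Finset.mul_sum]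
    rw [Finset.sum_comm]
    refine Finset.sum_congr rfl fun j _ => ?_
    calc _ = ∑ l, ∑ p, ∑ k, C l j k * (m.H j p * m.chr k l p) :=
          Finset.sum_congr rfl fun l _ => Finset.sum_comm
      _ = ∑ p, ∑ l, ∑ k, C l j k * (m.H j p * m.chr k l p) := Finset.sum_comm
      _ = _ := Finset.sum_congr rfl fun _ _ => Finset.sum_congr rfl fun _ _ =>
          Finset.sum_congr rfl fun _ _ => by ring
  simp only [div, map_sum, Derivation.leibniz, smul_eq_mul, m.d_H, mul_sub, mul_neg,
    mul_add, Finset.sum_add_distrib, Finset.sum_sub_distrib, Finset.sum_neg_distrib]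
  rw [e0, e1, e2, e3]
  ring

/-! ### Variation formulas -/

variable (D : Derivation ℝ A A) (hD : ∀ i a, D (m.d i a) = m.d i (D a))
include hD

/-- Apply `D` to the lowered formula for Γ: the term Dg·Γ from the product rule is what completes
the partial derivatives of Dg to covariant ones. -/
theorem variation_chr_lower (p i j : ι) :
    2 * ∑ k, m.g p k * D (m.chr k i j) = m.cov (fun i j => D (m.g i j)) i j p
      + m.cov (fun i j => D (m.g i j)) j i p - m.cov (fun i j => D (m.g i j)) p i j := by
  have h := congrArg D (m.sum_g_chr p i j)
  have h2 : D 2 = 0 := by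
    have := D.map_natCast 2
    simpa using this
  simp only [Derivation.leibniz, map_sum, map_add, map_sub, hD, smul_eq_mul, h2, mul_zero,
    add_zero, Finset.sum_add_distrib] at h
  simp only [cov, Finset.sum_add_distrib]
  have e1 : ∑ x, m.chr x i j * D (m.g p x) = ∑ x, m.chr x i j * D (m.g x p) :=
    Finset.sum_congr rfl fun x _ => by rw [m.g_symm p x]
  rw [e1] at h
  simp only [m.chr_symm _ j i, m.chr_symm _ p i, m.chr_symm _ p j, m.g_symm j _]
  simp only [m.g_symm j _] at h
  linear_combination h

/-- The Palatini formula ∇ₗ(DΓˡⱼₖ) − ∇ⱼ(DΓˡₗₖ), with the covariant derivatives written out. -/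
theorem D_ric (j k : ι) : D (m.ric j k) = ∑ l, m.d l (D (m.chr l j k))
    - m.d j (∑ l, D (m.chr l l k))
    + ∑ l, ∑ p, (D (m.chr p j k) * m.chr l l p + m.chr p j k * D (m.chr l l p)
      - D (m.chr p l k) * m.chr l j p - m.chr p l k * D (m.chr l j p)) := by
  simp only [ric, riem, map_sum, map_add, map_sub, hD, Derivation.leibniz, smul_eq_mul,
    Finset.sum_add_distrib, Finset.sum_sub_distrib, mul_comm]
  ring

/-- Tracing the Palatini formula with the parallel tensor `H` makes the second-order part a pure
divergence, for any variation of the metric. -/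
theorem D_scal : D m.scal = ∑ j, ∑ k, D (m.H j k) * m.ric j k
    + m.div (fun l => ∑ j, ∑ k, m.H j k * D (m.chr l j k)
      - ∑ k, m.H l k * ∑ p, D (m.chr p p k)) := by
  have h : D m.scal = ∑ j, ∑ k, D (m.H j k) * m.ric j k + ∑ j, ∑ k, m.H j k * D (m.ric j k) := by
    simp only [scal, map_sum, Derivation.leibniz, smul_eq_mul, Finset.sum_add_distrib]
    rw [add_comm]
    simp only [mul_comm]
  have hsub : ∀ V W : ι → A, m.div (fun l => V l - W l) = m.div V - m.div W := by
    intro V W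
    simp only [div, map_sub, mul_sub, Finset.sum_sub_distrib]
    ring
  rw [h, add_right_inj, hsub, m.div_contract fun l j k => D (m.chr l j k),
    m.div_raise fun k => ∑ p, D (m.chr p p k)]
  simp only [← Finset.sum_sub_distrib, ← mul_sub]
  refine Finset.sum_congr rfl fun j _ => Finset.sum_congr rfl fun k _ => congrArg _ ?_
  rw [m.D_ric D hD]
  have e : ∑ l, ∑ p, m.chr p j k * D (m.chr l l p) = ∑ p, m.chr p j k * ∑ l, D (m.chr l l p) := by
    rw [Finset.sum_comm]
    simp only [Finset.mul_sum]
  simp only [← e, Finset.sum_add_distrib, Finset.sum_sub_distrib]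
  ring

/-! ### Ricci-Yamabe flow -/

variable {a b : A} (ha : ∀ i, m.d i a = 0) (hb : ∀ i, m.d i b = 0)
  (hflow : ∀ i j, D (m.g i j) = -(2 * a * m.ric i j) - b * m.scal * m.g i j)
include ha hb hflow

-- Only R is differentiated in the term bRg, because ∇g = 0 and a, b are constant in space.
omit hD in
theorem cov_flow (l i j : ι) : m.cov (fun i j => D (m.g i j)) l i j
    = -(2 * a * m.cov m.ric l i j) - b * m.d l m.scal * m.g i j := by
  have h2 : m.d l 2 = 0 := by simpa using (m.d l).map_natCast 2
  simp only [cov, hflow, map_sub, map_neg, Derivation.leibniz, smul_eq_mul, ha, hb, h2, mul_zero,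
    add_zero, Finset.sum_add_distrib, m.d_g l i j]
  have e1 : ∑ x, m.chr x l i * (-(2 * a * m.ric x j) - b * m.scal * m.g x j)
      = -(2 * a * ∑ x, m.chr x l i * m.ric x j) - b * m.scal * ∑ x, m.chr x l i * m.g x j := by
    rw [Finset.mul_sum, Finset.mul_sum, ← Finset.sum_neg_distrib, ← Finset.sum_sub_distrib]
    exact Finset.sum_congr rfl fun _ _ => by ring
  have e2 : ∑ x, m.chr x l j * (-(2 * a * m.ric i x) - b * m.scal * m.g i x)
      = -(2 * a * ∑ x, m.chr x l j * m.ric i x) - b * m.scal * ∑ x, m.g i x * m.chr x l j := by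
    rw [Finset.mul_sum, Finset.mul_sum, ← Finset.sum_neg_distrib, ← Finset.sum_sub_distrib]
    exact Finset.sum_congr rfl fun _ _ => by ring
  rw [e1, e2]
  ring

theorem D_chr (k i j : ι) : D (m.chr k i j) =
    a * ∑ l, m.H k l * (m.cov m.ric l i j - m.cov m.ric i j l - m.cov m.ric j i l)
      - half A * b * (m.d i m.scal * (1 : Matrix ι ι A) k j + m.d j m.scal * (1 : Matrix ι ι A) k i
        - m.grad m.scal k * m.g i j) := by
  refine m.ext_of_sum_g (X := fun k => D (m.chr k i j)) (Y := fun k =>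
    a * ∑ l, m.H k l * (m.cov m.ric l i j - m.cov m.ric i j l - m.cov m.ric j i l)
      - half A * b * (m.d i m.scal * (1 : Matrix ι ι A) k j + m.d j m.scal * (1 : Matrix ι ι A) k i
        - m.grad m.scal k * m.g i j)) (fun p => ?_) k
  apply eq_of_two_mul
  rw [m.variation_chr_lower D hD]
  simp only [m.cov_flow D ha hb hflow]
  have e : ∑ k, m.g p k * (a * ∑ l, m.H k l * (m.cov m.ric l i j - m.cov m.ric i j l
        - m.cov m.ric j i l) - half A * b * (m.d i m.scal * (1 : Matrix ι ι A) k j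
        + m.d j m.scal * (1 : Matrix ι ι A) k i - m.grad m.scal k * m.g i j))
      = a * ∑ k, m.g p k * ∑ l, m.H k l * (m.cov m.ric l i j - m.cov m.ric i j l
        - m.cov m.ric j i l) - half A * b * (m.d i m.scal * ∑ k, m.g p k * (1 : Matrix ι ι A) k j
        + m.d j m.scal * ∑ k, m.g p k * (1 : Matrix ι ι A) k i
        - (∑ k, m.g p k * ∑ l, m.H k l * m.d l m.scal) * m.g i j) := by
    simp only [mul_add, mul_sub, Finset.mul_sum, Finset.sum_mul, Finset.sum_sub_distrib,
      Finset.sum_add_distrib, grad]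
    simp only [← Finset.mul_sum, mul_left_comm, mul_assoc]
  rw [e, m.sum_g_H (fun l => m.cov m.ric l i j - m.cov m.ric i j l - m.cov m.ric j i l),
    m.sum_g_H (fun l => m.d l m.scal)]
  simp only [Matrix.one_apply, mul_ite, mul_one, mul_zero, Finset.sum_ite_eq', Finset.mem_univ,
    if_true]
  rw [m.g_symm p j, m.g_symm p i]
  linear_combination (b * (m.d i m.scal * m.g j p + m.d j m.scal * m.g i p
    - m.d p m.scal * m.g i j)) * two_mul_half (A := A)

/-- The a-part is ∇R minus twice the divergence of Ric, which vanishes by the contracted Bianchi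
identity. In the b-part the three terms contribute 1 + 1 − n copies of the gradient. -/
theorem contract_D_chr (l : ι) : ∑ j, ∑ k, m.H j k * D (m.chr l j k)
    = half A * b * (Fintype.card ι - 2) * m.grad m.scal l := by
  have h1 : ∀ p, ∑ j, ∑ k, m.H j k *
      (m.cov m.ric p j k - m.cov m.ric j k p - m.cov m.ric k j p) = 0 := by
    intro p
    have e : ∑ j, ∑ k, m.H j k * m.cov m.ric k j p = ∑ j, ∑ k, m.H j k * m.cov m.ric j k p := by
      rw [Finset.sum_comm]
      exact Finset.sum_congr rfl fun j _ => Finset.sum_congr rfl fun k _ => by rw [m.H_symm]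
    simp only [mul_sub, Finset.sum_sub_distrib]
    rw [e, m.sum_H_cov]
    change m.d p m.scal - _ - _ = 0
    rw [← m.contracted_bianchi p]
    ring
  have h2 : ∑ j, ∑ k, m.H j k * ∑ p, m.H l p *
      (m.cov m.ric p j k - m.cov m.ric j k p - m.cov m.ric k j p) = 0 := by
    calc _ = ∑ p, m.H l p * ∑ j, ∑ k, m.H j k *
          (m.cov m.ric p j k - m.cov m.ric j k p - m.cov m.ric k j p) := by
          simp only [Finset.mul_sum]
          rw [Finset.sum_congr rfl fun x _ => Finset.sum_comm, Finset.sum_comm]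
          exact Finset.sum_congr rfl fun _ _ => Finset.sum_congr rfl fun _ _ =>
            Finset.sum_congr rfl fun _ _ => by ring
      _ = 0 := by simp [h1]
  have h3 : ∑ j, ∑ k, m.H j k * m.g j k = Fintype.card ι := by
    have e : (m.H * m.g).trace = Fintype.card ι := by rw [m.H_mul_g, Matrix.trace_one]
    rw [← e]
    simp only [Matrix.trace, Matrix.diag, Matrix.mul_apply]
    exact Finset.sum_congr rfl fun j _ => Finset.sum_congr rfl fun k _ => by rw [m.g_symm]
  have h4 : ∑ j, ∑ k, m.H j k * (m.d j m.scal * (1 : Matrix ι ι A) l k) = m.grad m.scal l := by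
    simp only [Matrix.one_apply, mul_ite, mul_one, mul_zero, Finset.sum_ite_eq, Finset.mem_univ,
      if_true, grad]
    exact Finset.sum_congr rfl fun j _ => by rw [m.H_symm]
  have h5 : ∑ j, ∑ k, m.H j k * (m.d k m.scal * (1 : Matrix ι ι A) l j) = m.grad m.scal l := by
    rw [Finset.sum_comm, ← h4]
    exact Finset.sum_congr rfl fun j _ => Finset.sum_congr rfl fun k _ => by rw [m.H_symm]
  have e : ∑ j, ∑ k, m.H j k * D (m.chr l j k)
      = a * (∑ j, ∑ k, m.H j k * ∑ p, m.H l p *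
        (m.cov m.ric p j k - m.cov m.ric j k p - m.cov m.ric k j p))
      - half A * b * (∑ j, ∑ k, m.H j k * (m.d j m.scal * (1 : Matrix ι ι A) l k)
        + ∑ j, ∑ k, m.H j k * (m.d k m.scal * (1 : Matrix ι ι A) l j)
        - m.grad m.scal l * ∑ j, ∑ k, m.H j k * m.g j k) := by
    have e' : ∀ j k, m.H j k * D (m.chr l j k) = a * (m.H j k * ∑ p, m.H l p *
        (m.cov m.ric p j k - m.cov m.ric j k p - m.cov m.ric k j p))
        - half A * b * (m.H j k * (m.d j m.scal * (1 : Matrix ι ι A) l k)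
        + m.H j k * (m.d k m.scal * (1 : Matrix ι ι A) l j)
        - m.grad m.scal l * (m.H j k * m.g j k)) := by
      intro j k
      rw [m.D_chr D hD ha hb hflow]
      ring
    simp only [e', Finset.sum_add_distrib, Finset.sum_sub_distrib, ← Finset.mul_sum]
  rw [e, h2, h3, h4, h5]
  ring

/-- In the a-part the first two terms cancel by symmetry and the third is −∇R; the b-part
contributes 1 + n − 1 copies of ∇R. -/
theorem trace_D_chr (k : ι) : ∑ p, D (m.chr p p k)
    = -(a + half A * b * Fintype.card ι) * m.d k m.scal := by
  have h1 : ∑ p, ∑ l, m.H p l * (m.cov m.ric l p k - m.cov m.ric p k l - m.cov m.ric k p l)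
      = -m.d k m.scal := by
    have e : ∑ j, ∑ l, m.H j l * m.cov m.ric l j k = ∑ j, ∑ l, m.H j l * m.cov m.ric j k l := by
      rw [Finset.sum_comm]
      exact Finset.sum_congr rfl fun j _ => Finset.sum_congr rfl fun l _ => by
        rw [m.H_symm, m.cov_symm m.ric_symm]
    simp only [mul_sub, Finset.sum_sub_distrib]
    rw [e, m.sum_H_cov, sub_self, zero_sub]
    rfl
  have h2 : ∑ p, m.d p m.scal * (1 : Matrix ι ι A) p k = m.d k m.scal := by
    simp [Matrix.one_apply]
  have h3 : ∑ p, m.grad m.scal p * m.g p k = m.d k m.scal := by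
    rw [← m.sum_g_H (fun l => m.d l m.scal) k]
    exact Finset.sum_congr rfl fun p _ => by rw [m.g_symm p k, mul_comm]; rfl
  have h4 : ∑ p : ι, m.d k m.scal * (1 : Matrix ι ι A) p p = Fintype.card ι * m.d k m.scal := by
    simp
  simp only [m.D_chr D hD ha hb hflow, Finset.sum_sub_distrib, Finset.sum_add_distrib,
    ← Finset.mul_sum]
  rw [h1, h2, h3]
  rw [Finset.mul_sum, h4]
  ring

-- Differentiating gH = 1 gives DH = −H(Dg)H, which is 2a Ric + bRg with both indices raised.
omit ha hb hD in
theorem sum_D_H_ric : ∑ j, ∑ k, D (m.H j k) * m.ric j k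
    = 2 * a * m.normSq + b * m.scal ^ 2 := by
  have h : m.g.map D = -((2 * a) • Matrix.of m.ric) - (b * m.scal) • m.g := by
    ext i j
    simp [hflow i j]
  have h2 : m.H.map D = (2 * a) • (m.H * Matrix.of m.ric * m.H) + (b * m.scal) • m.H := by
    rw [map_derivation_H, h]
    simp only [mul_sub, sub_mul, mul_neg, neg_mul, Matrix.mul_smul, Matrix.smul_mul, m.H_mul_g,
      one_mul]
    abel
  have h3 : ∀ j k, D (m.H j k) = 2 * a * ∑ q, (∑ p, m.H j p * m.ric p q) * m.H q k
      + b * m.scal * m.H j k := by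
    intro j k
    have := congrFun (congrFun h2 j) k
    simpa [Matrix.mul_apply] using this
  simp only [h3, add_mul, Finset.sum_add_distrib]
  congr 1
  · simp only [normSq, Finset.mul_sum, Finset.sum_mul]
    refine Finset.sum_congr rfl fun i _ => Finset.sum_congr rfl fun j _ => ?_
    rw [Finset.sum_comm]
    refine Finset.sum_congr rfl fun k _ => Finset.sum_congr rfl fun l _ => ?_
    rw [m.H_symm l j]
    ring
  · rw [sq]
    nth_rw 3 [scal]
    simp only [Finset.mul_sum]
    exact Finset.sum_congr rfl fun i _ => Finset.sum_congr rfl fun j _ => by ring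

omit ha hb hflow hD in
theorem div_const_mul {c : A} (hc : ∀ i, m.d i c = 0) (V : ι → A) :
    m.div (fun l => c * V l) = c * m.div V := by
  simp only [div, Derivation.leibniz, hc, smul_eq_mul, mul_zero, add_zero, mul_left_comm _ c,
    ← Finset.mul_sum, mul_add]

theorem D_scal_flow : D m.scal = (a + (Fintype.card ι - 1) * b) * m.lap m.scal
    + 2 * a * m.normSq + b * m.scal ^ 2 := by
  have hc : ∀ i, m.d i (a + (Fintype.card ι - 1) * b) = 0 := by
    intro i
    simp [ha, hb]
  rw [m.D_scal D hD, m.sum_D_H_ric D hflow, lap_eq, ← m.div_const_mul hc]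
  -- The coefficients combine as b(n − 2)/2 + a + bn/2 = a + (n − 1)b.
  have e : (fun l => ∑ j, ∑ k, m.H j k * D (m.chr l j k) - ∑ k, m.H l k * ∑ p, D (m.chr p p k))
      = fun l => (a + (Fintype.card ι - 1) * b) * m.grad m.scal l := by
    funext l
    simp only [m.contract_D_chr D hD ha hb hflow, m.trace_D_chr D hD ha hb hflow]
    have : ∑ k, m.H l k * (-(a + half A * b * Fintype.card ι) * m.d k m.scal)
        = -(a + half A * b * Fintype.card ι) * m.grad m.scal l := by
      rw [grad, Finset.mul_sum]
      exact Finset.sum_congr rfl fun _ _ => by ring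
    rw [this]
    linear_combination (b * (Fintype.card ι - 1) * m.grad m.scal l) * two_mul_half (A := A)
  rw [e]
  ring

end MetricAlgebra

/-! ### Surfaces -/

namespace MetricAlgebra

variable {A : Type*} [CommRing A] [Algebra ℝ A] (m : MetricAlgebra (Fin 2) A)

/-- The curvature component `g(Rm(∂_0, ∂_1) ∂_1, ∂_0)` of a surface. -/
noncomputable def rho : A := ∑ p, m.g 0 p * m.riem p 0 1 1

/-- The lowered curvature matrix B = gF is antisymmetric of size two, hence determined by `rho`.
Contracting F = HB gives `rho` times the adjugate of `H`, so Ric is proportional to g. -/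
theorem ric_surface : m.ric 0 0 = m.H 1 1 * m.rho ∧ m.ric 0 1 = -(m.H 0 1 * m.rho) ∧
    m.ric 1 0 = -(m.H 0 1 * m.rho) ∧ m.ric 1 1 = m.H 0 0 * m.rho := by
  have hanti := m.g_mul_curv 0 1
  have hF : m.curv 0 1 = m.H * (m.g * m.curv 0 1) := by
    rw [← mul_assoc, m.H_mul_g, one_mul]
  have hz : ∀ i l k, m.riem l i i k = 0 := by
    intro i l k
    simp [riem]
  have hs : ∀ l k, m.riem l 1 0 k = -m.riem l 0 1 k := by
    intro l k
    exact congrFun (congrFun (m.curv_swap 0 1) l) k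
  generalize hB : m.g * m.curv 0 1 = B at hanti hF
  have ht : (m.curv 0 1)ᵀ * m.g = Bᵀ := by
    rw [← hB, Matrix.transpose_mul, m.g_transpose]
  rw [ht] at hanti
  have hρ : B 0 1 = m.rho := by
    rw [← hB]; rfl
  have h00 : B 0 0 = 0 := eq_of_two_mul (by
    have := congrFun (congrFun hanti 0) 0
    simp only [Matrix.add_apply, Matrix.transpose_apply, Matrix.zero_apply] at this
    rw [two_mul, this, mul_zero])
  have h11 : B 1 1 = 0 := eq_of_two_mul (by
    have := congrFun (congrFun hanti 1) 1
    simp only [Matrix.add_apply, Matrix.transpose_apply, Matrix.zero_apply] at this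
    rw [two_mul, this, mul_zero])
  have h10 : B 1 0 = -m.rho := by
    have := congrFun (congrFun hanti 1) 0
    simp only [Matrix.add_apply, Matrix.transpose_apply, Matrix.zero_apply] at this
    rw [← hρ]; exact eq_neg_of_add_eq_zero_left this
  have hR : ∀ l k, m.riem l 0 1 k = m.H l 0 * B 0 k + m.H l 1 * B 1 k := by
    intro l k
    have := congrFun (congrFun hF l) k
    rw [Matrix.mul_apply, Fin.sum_univ_two] at this
    exact this
  simp only [ric, Fin.sum_univ_two, hz, hs, hR, h00, h11, h10, hρ, m.H_symm 1 0]
  refine ⟨?_, ?_, ?_, ?_⟩ <;> ring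

theorem det_g_mul_det_H :
    (m.g 0 0 * m.g 1 1 - m.g 0 1 ^ 2) * (m.H 0 0 * m.H 1 1 - m.H 0 1 ^ 2) = 1 := by
  have h := congrArg Matrix.det m.g_mul_H
  rw [Matrix.det_mul, Matrix.det_one, Matrix.det_fin_two, Matrix.det_fin_two, m.g_symm 1 0,
    m.H_symm 1 0] at h
  rw [sq, sq, h]

theorem scal_surface : m.scal * (m.g 0 0 * m.g 1 1 - m.g 0 1 ^ 2) = 2 * m.rho := by
  obtain ⟨h1, h2, h3, h4⟩ := m.ric_surface
  simp only [scal, Fin.sum_univ_two, h1, h2, h3, h4, m.H_symm 1 0]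
  linear_combination (2 * m.rho) * m.det_g_mul_det_H

theorem normSq_surface : 2 * m.normSq = m.scal ^ 2 := by
  obtain ⟨h1, h2, h3, h4⟩ := m.ric_surface
  simp only [scal, normSq, Fin.sum_univ_two, h1, h2, h3, h4, m.H_symm 1 0]
  ring

end MetricAlgebra

/-! ### The algebra of smooth functions on an open set -/

section SmoothFun

open TopologicalSpace Filter Topology

variable {E : Type*} [NormedAddCommGroup E] [NormedSpace ℝ E]

/-- The algebra of smooth real functions on an open set. -/
def smoothFun (S : Opens E) : Subalgebra ℝ (S → ℝ) where
  carrier := {f | ∃ F : E → ℝ, ContDiffOn ℝ ∞ F S ∧ ∀ x : S, f x = F x}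
  mul_mem' := by
    rintro f f' ⟨F, hF, h⟩ ⟨F', hF', h'⟩
    exact ⟨fun x => F x * F' x, hF.mul hF', fun x => by simp [h, h']⟩
  add_mem' := by
    rintro f f' ⟨F, hF, h⟩ ⟨F', hF', h'⟩
    exact ⟨fun x => F x + F' x, hF.add hF', fun x => by simp [h, h']⟩
  algebraMap_mem' r := ⟨fun _ => r, contDiffOn_const, fun x => rfl⟩

variable {S : Opens E}

/-- An extension of a smooth function to the whole space. -/
noncomputable def smoothExt (f : smoothFun S) : E → ℝ := f.2.choose

theorem contDiffOn_smoothExt (f : smoothFun S) : ContDiffOn ℝ ∞ (smoothExt f) S := f.2.choose_spec.1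

theorem smoothExt_apply (f : smoothFun S) (x : S) : smoothExt f x = f.1 x := (f.2.choose_spec.2 x).symm

theorem contDiffAt_smoothExt (f : smoothFun S) (x : S) : ContDiffAt ℝ ∞ (smoothExt f) x :=
  (contDiffOn_smoothExt f).contDiffAt (S.isOpen.mem_nhds x.2)

theorem differentiableAt_smoothExt (f : smoothFun S) (x : S) : DifferentiableAt ℝ (smoothExt f) x :=
  (contDiffAt_smoothExt f x).differentiableAt (by simp)

theorem smoothExt_eventuallyEq (f : smoothFun S) (x : S) {F : E → ℝ} (h : ∀ z : S, F z = f.1 z) :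
    F =ᶠ[𝓝 (x : E)] smoothExt f := by
  filter_upwards [S.isOpen.mem_nhds x.2] with z hz
  rw [h ⟨z, hz⟩, ← smoothExt_apply]

/-- The directional derivative, as a function on the open set. -/
noncomputable def dirDerivFun (v : E) (f : smoothFun S) : smoothFun S :=
  ⟨fun x => fderiv ℝ (smoothExt f) x v, fun x => fderiv ℝ (smoothExt f) x v,
    ((contDiffOn_smoothExt f).fderiv_of_isOpen S.isOpen (by simp)).clm_apply contDiffOn_const,
    fun _ => rfl⟩

/-- At a point of an open set the derivative depends only on the germ, so any extension may replace
the chosen one. -/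
theorem dirDerivFun_apply (v : E) (f : smoothFun S) (x : S) {F : E → ℝ}
    (h : ∀ z : S, F z = f.1 z) : (dirDerivFun v f).1 x = fderiv ℝ F x v := by
  rw [(smoothExt_eventuallyEq f x h).fderiv_eq]
  rfl

/-- The directional derivative, as a derivation. -/
noncomputable def dirDeriv (S : Opens E) (v : E) : Derivation ℝ (smoothFun S) (smoothFun S) :=
  Derivation.mk'
    { toFun := dirDerivFun v
      map_add' := fun f f' => by
        ext x
        rw [dirDerivFun_apply v (f + f') x (F := fun z => smoothExt f z + smoothExt f' z)
          (fun z => by rw [smoothExt_apply, smoothExt_apply]; rfl),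
          fderiv_fun_add (differentiableAt_smoothExt f x) (differentiableAt_smoothExt f' x)]
        rfl
      map_smul' := fun c f => by
        ext x
        rw [dirDerivFun_apply v (c • f) x (F := fun z => c • smoothExt f z)
          (fun z => by rw [smoothExt_apply]; rfl), fderiv_fun_const_smul (differentiableAt_smoothExt f x)]
        rfl }
    fun f f' => by
      ext x
      change (dirDerivFun v (f * f')).1 x = _
      rw [dirDerivFun_apply v (f * f') x (F := fun z => smoothExt f z * smoothExt f' z)
          (fun z => by rw [smoothExt_apply, smoothExt_apply]; rfl),
          fderiv_fun_mul (differentiableAt_smoothExt f x) (differentiableAt_smoothExt f' x),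
          smoothExt_apply, smoothExt_apply]
      rfl

theorem dirDeriv_apply (v : E) (f : smoothFun S) (x : S) :
    (dirDeriv S v f).1 x = fderiv ℝ (smoothExt f) x v := rfl

theorem dirDeriv_comm (v w : E) (f : smoothFun S) :
    dirDeriv S v (dirDeriv S w f) = dirDeriv S w (dirDeriv S v f) := by
  have key : ∀ (v w : E) (x : S), (dirDeriv S v (dirDeriv S w f)).1 x
      = fderiv ℝ (fderiv ℝ (smoothExt f)) x v w := by
    intro v w x
    have h : (dirDeriv S v (dirDeriv S w f)).1 x = fderiv ℝ (fun z => fderiv ℝ (smoothExt f) z w) x v :=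
      dirDerivFun_apply v _ x fun z => rfl
    have hd : DifferentiableAt ℝ (fderiv ℝ (smoothExt f)) x :=
      ((contDiffAt_smoothExt f x).fderiv_right (m := 1) (by norm_cast)).differentiableAt (by simp)
    rw [h, fderiv_clm_apply hd (differentiableAt_const _)]
    simp
  ext x
  rw [key, key]
  exact ((contDiffAt_smoothExt f x).isSymmSndFDerivAt (by
    rw [minSmoothness_of_isRCLikeNormedField]; norm_cast)) v w

/-- Evaluation of smooth functions at a point. -/
noncomputable def evalAt (x : S) : smoothFun S →ₐ[ℝ] ℝ :=
  (Pi.evalAlgHom ℝ _ x).comp (smoothFun S).val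

theorem evalAt_apply (x : S) (f : smoothFun S) : evalAt x f = f.1 x := rfl

theorem isUnit_smoothFun {f : smoothFun S} (hf : ∀ x, f.1 x ≠ 0) : IsUnit f := by
  refine IsUnit.of_mul_eq_one ⟨fun x => (f.1 x)⁻¹, (smoothExt f)⁻¹, (contDiffOn_smoothExt f).inv
    (fun x hx => by rw [smoothExt_apply f ⟨x, hx⟩]; exact hf _), fun x => by simp [smoothExt_apply]⟩ ?_
  ext x
  exact mul_inv_cancel₀ (hf x)

variable {n : ℕ}

/-- The bridge from coordinates to the algebra. Agreement with `f` is required on the whole time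
slice, so each translated quantity can be differentiated in turn: metric, Γ, Rm, R, second
derivatives of R. -/
theorem pd_eq {S : Opens (ℝ × Coord n)} {t : ℝ} {y : Coord n} (h : (t, y) ∈ S) (f : smoothFun S)
    {u : Coord n → ℝ} (hu : ∀ z (hz : (t, z) ∈ S), u z = evalAt ⟨(t, z), hz⟩ f) (k : Fin n) :
    pd u k y = evalAt ⟨(t, y), h⟩ (dirDeriv S (0, EuclideanSpace.single k 1) f) := by
  have hcont : Continuous fun z : Coord n => (t, z) := by fun_prop
  have hev : u =ᶠ[𝓝 y] fun z => smoothExt f (t, z) := by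
    filter_upwards [(S.isOpen.preimage hcont).mem_nhds h] with z hz
    rw [hu z hz, evalAt_apply, ← smoothExt_apply]
  have hd : HasFDerivAt (fun z : Coord n => (t, z)) (ContinuousLinearMap.inr ℝ ℝ (Coord n)) y :=
    hasFDerivAt_prodMk_right t y
  have hc := (differentiableAt_smoothExt f ⟨(t, y), h⟩).hasFDerivAt.comp y hd
  rw [pd, hev.fderiv_eq, evalAt_apply, dirDeriv_apply]
  change fderiv ℝ (smoothExt f ∘ fun z => (t, z)) y _ = _
  rw [hc.fderiv]
  simp

theorem hasDerivAt_evalAt {S : Opens (ℝ × Coord n)} {t : ℝ} {y : Coord n} (h : (t, y) ∈ S)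
    (f : smoothFun S) {u : ℝ → ℝ} (hu : ∀ s (hs : (s, y) ∈ S), u s = evalAt ⟨(s, y), hs⟩ f) :
    HasDerivAt u (evalAt ⟨(t, y), h⟩ (dirDeriv S (1, 0) f)) t := by
  have hcont : Continuous fun s : ℝ => (s, y) := by fun_prop
  have hev : u =ᶠ[𝓝 t] fun s => smoothExt f (s, y) := by
    filter_upwards [(S.isOpen.preimage hcont).mem_nhds h] with s hs
    rw [hu s hs, evalAt_apply, ← smoothExt_apply]
  have hd : HasFDerivAt (fun s : ℝ => (s, y)) (ContinuousLinearMap.inl ℝ ℝ (Coord n)) t :=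
    hasFDerivAt_prodMk_left t y
  have hc := ((differentiableAt_smoothExt f ⟨(t, y), h⟩).hasFDerivAt.comp t hd).hasDerivAt
  rw [ContinuousLinearMap.comp_apply, ContinuousLinearMap.inl_apply] at hc
  exact HasDerivAt.congr_of_eventuallyEq hc hev

end SmoothFun

/-! ### The metric algebra of a time-dependent metric in coordinates -/

section Coordinates

open TopologicalSpace

variable {n : ℕ}

/-- Time-dependent metric coefficients, smooth on an open set of space-time. -/
structure IsMetricOn (S : Opens (ℝ × Coord n)) (G : ℝ → Coord n → Matrix (Fin n) (Fin n) ℝ) :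
    Prop where
  smooth : ∀ i j, ContDiffOn ℝ ∞ (fun p : ℝ × Coord n => G p.1 p.2 i j) S
  symm : ∀ t y i j, G t y i j = G t y j i
  det_ne : ∀ p ∈ S, (G p.1 p.2).det ≠ 0

namespace IsMetricOn

variable {S : Opens (ℝ × Coord n)} {G : ℝ → Coord n → Matrix (Fin n) (Fin n) ℝ}
  (hG : IsMetricOn S G)

/-- The metric as a matrix of smooth functions. -/
def metric : Matrix (Fin n) (Fin n) (smoothFun S) :=
  Matrix.of fun i j => ⟨fun x => G x.1.1 x.1.2 i j, _, hG.smooth i j, fun _ => rfl⟩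

theorem map_metric (x : S) : (evalAt x).toRingHom.mapMatrix hG.metric = G x.1.1 x.1.2 := rfl

theorem isUnit_det : IsUnit hG.metric.det := by
  refine isUnit_smoothFun fun x => ?_
  have := RingHom.map_det (evalAt x).toRingHom hG.metric
  rw [map_metric] at this
  change (evalAt x).toRingHom hG.metric.det ≠ 0
  rw [this]
  exact hG.det_ne x x.2

/-- The metric algebra of smooth functions on the domain of a time-dependent metric. -/
noncomputable def alg : MetricAlgebra (Fin n) (smoothFun S) where
  d i := dirDeriv S (0, EuclideanSpace.single i 1)
  d_comm i j f := dirDeriv_comm _ _ f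
  g := hG.metric
  H := hG.metric⁻¹
  g_symm i j := by
    ext x
    exact hG.symm _ _ i j
  g_mul_H := Matrix.mul_nonsing_inv _ hG.isUnit_det

/-- The time derivative. -/
noncomputable def timeDeriv (S : Opens (ℝ × Coord n)) :
    Derivation ℝ (smoothFun S) (smoothFun S) := dirDeriv S (1, 0)

variable {t : ℝ} {y : Coord n} (h : (t, y) ∈ S)

theorem g_eq (i j : Fin n) : G t y i j = evalAt ⟨(t, y), h⟩ (hG.alg.g i j) := rfl

/-- Evaluation is a ring homomorphism, so it sends the inverse matrix over the algebra to a right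
inverse of the evaluated metric. -/
theorem H_eq (i j : Fin n) : (G t y)⁻¹ i j = evalAt ⟨(t, y), h⟩ (hG.alg.H i j) := by
  have h1 := congrArg (evalAt ⟨(t, y), h⟩).toRingHom.mapMatrix hG.alg.g_mul_H
  rw [map_mul, map_one] at h1
  have h2 : G t y * (evalAt ⟨(t, y), h⟩).toRingHom.mapMatrix hG.alg.H = 1 := h1
  rw [Matrix.inv_eq_right_inv h2]
  rfl

theorem half_eq (x : S) : evalAt x (MetricAlgebra.half (smoothFun S)) = 1 / 2 :=
  (evalAt x).commutes _

include h

theorem christoffel_eq (k i j : Fin n) :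
    christoffel (G t) k i j y = evalAt ⟨(t, y), h⟩ (hG.alg.chr k i j) := by
  have hp : ∀ i j k, pd (fun z => G t z i j) k y = evalAt ⟨(t, y), h⟩ (hG.alg.d k (hG.alg.g i j)) :=
    fun i j k => pd_eq h _ (fun z hz => hG.g_eq hz i j) k
  simp only [christoffel, MetricAlgebra.chr, map_mul, map_sum, map_add, map_sub, half_eq, hp,
    hG.H_eq h]

theorem riemann_eq (l i j k : Fin n) :
    riemann (G t) l i j k y = evalAt ⟨(t, y), h⟩ (hG.alg.riem l i j k) := by
  have hp : ∀ l i j k, pd (christoffel (G t) l i j) k y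
      = evalAt ⟨(t, y), h⟩ (hG.alg.d k (hG.alg.chr l i j)) :=
    fun l i j k => pd_eq h _ (fun z hz => hG.christoffel_eq hz l i j) k
  simp only [riemann, MetricAlgebra.riem, map_mul, map_sum, map_add, map_sub, hp,
    hG.christoffel_eq h]

theorem ricci_eq (j k : Fin n) :
    ricci (G t) j k y = evalAt ⟨(t, y), h⟩ (hG.alg.ric j k) := by
  simp only [ricci, MetricAlgebra.ric, map_sum, hG.riemann_eq h]

theorem scalarCurv_eq : scalarCurv (G t) y = evalAt ⟨(t, y), h⟩ hG.alg.scal := by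
  simp only [scalarCurv, MetricAlgebra.scal, map_sum, map_mul, hG.ricci_eq h, hG.H_eq h]

theorem pd_scalarCurv_eq (k : Fin n) :
    pd (scalarCurv (G t)) k y = evalAt ⟨(t, y), h⟩ (hG.alg.d k hG.alg.scal) :=
  pd_eq h _ (fun _ hz => hG.scalarCurv_eq hz) k

theorem covDeriv_ricci_eq (l i j : Fin n) :
    covDeriv (G t) (ricci (G t)) l i j y
      = evalAt ⟨(t, y), h⟩ (hG.alg.cov hG.alg.ric l i j) := by
  have hp : pd (ricci (G t) i j) l y = evalAt ⟨(t, y), h⟩ (hG.alg.d l (hG.alg.ric i j)) :=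
    pd_eq h _ (fun z hz => hG.ricci_eq hz i j) l
  simp only [covDeriv, MetricAlgebra.cov, map_sum, map_sub, map_add, map_mul, hp, hG.ricci_eq h,
    hG.christoffel_eq h]

theorem gradUp_scalarCurv_eq (k : Fin n) :
    gradUp (G t) (scalarCurv (G t)) k y = evalAt ⟨(t, y), h⟩ (hG.alg.grad hG.alg.scal k) := by
  simp only [gradUp, MetricAlgebra.grad, map_sum, map_mul, hG.H_eq h, hG.pd_scalarCurv_eq h]

theorem laplacian_scalarCurv_eq :
    laplacian (G t) (scalarCurv (G t)) y = evalAt ⟨(t, y), h⟩ (hG.alg.lap hG.alg.scal) := by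
  have hp : ∀ i j, pd (pd (scalarCurv (G t)) j) i y
      = evalAt ⟨(t, y), h⟩ (hG.alg.d i (hG.alg.d j hG.alg.scal)) :=
    fun i j => pd_eq h _ (fun z hz => hG.pd_scalarCurv_eq hz j) i
  simp only [laplacian, MetricAlgebra.lap, map_sum, map_sub, map_mul, hp, hG.H_eq h,
    hG.christoffel_eq h, hG.pd_scalarCurv_eq h]

theorem ricciNormSq_eq : ricciNormSq (G t) y = evalAt ⟨(t, y), h⟩ hG.alg.normSq := by
  simp only [ricciNormSq, MetricAlgebra.normSq, map_sum, map_mul, hG.H_eq h, hG.ricci_eq h]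

end IsMetricOn
end Coordinates

/-! ### Evolution equations in coordinates -/

open TopologicalSpace Filter Topology

/-- Jacobi's formula. -/
theorem hasDerivAt_det {n : ℕ} {G : ℝ → Matrix (Fin n) (Fin n) ℝ} {G' : Matrix (Fin n) (Fin n) ℝ}
    {t : ℝ} (h : ∀ i j, HasDerivAt (fun s => G s i j) (G' i j) t) :
    HasDerivAt (fun s => (G s).det) ((G t).adjugate * G').trace t := by
  simp only [Matrix.det_apply']
  have h1 : HasDerivAt (fun s => ∑ σ : Equiv.Perm (Fin n), (Equiv.Perm.sign σ : ℤ) *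
      ∏ i, G s (σ i) i) (∑ σ : Equiv.Perm (Fin n), ((Equiv.Perm.sign σ : ℤ) : ℝ) *
      ∑ i, (∏ j ∈ Finset.univ.erase i, G t (σ j) j) • G' (σ i) i) t :=
    HasDerivAt.fun_sum fun σ _ =>
      (HasDerivAt.fun_finsetProd fun i _ => h (σ i) i).const_mul _
  convert h1 using 1
  -- Cramer's rule: each diagonal entry is the determinant with one column differentiated, matching
  -- the product rule in the Leibniz expansion.
  have h2 : ∀ i, ((G t).adjugate * G') i i = ((G t).updateCol i fun k => G' k i).det := by
    intro i
    rw [← Matrix.cramer_apply, Matrix.cramer_eq_adjugate_mulVec]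
    rfl
  simp only [Matrix.trace, Matrix.diag, h2, Matrix.det_apply', Finset.mul_sum]
  rw [Finset.sum_comm]
  refine Finset.sum_congr rfl fun σ _ => Finset.sum_congr rfl fun i _ => ?_
  rw [← Finset.mul_prod_erase _ _ (Finset.mem_univ i), Matrix.updateCol_self, smul_eq_mul,
    mul_comm (G' (σ i) i)]
  congr 2
  refine Finset.prod_congr rfl fun j hj => ?_
  rw [Matrix.updateCol_ne (Finset.ne_of_mem_erase hj)]

/-- The Ricci-Yamabe flow equation for metric coefficients on an open set of space-time. -/
def IsLocalFlow {n : ℕ} (α β : ℝ) (S : Opens (ℝ × Coord n))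
    (G : ℝ → Coord n → Matrix (Fin n) (Fin n) ℝ) : Prop :=
  ∀ t y, (t, y) ∈ S → ∀ i j, deriv (fun s => G s y i j) t + 2 * α * ricci (G t) i j y
    + β * scalarCurv (G t) y * G t y i j = 0

namespace IsMetricOn

variable {n : ℕ} {S : Opens (ℝ × Coord n)} {G : ℝ → Coord n → Matrix (Fin n) (Fin n) ℝ}
  (hG : IsMetricOn S G) {t : ℝ} {y : Coord n} (h : (t, y) ∈ S)

include h in
theorem hasDerivAt_coeff (i j : Fin n) : HasDerivAt (fun s => G s y i j)
    (evalAt ⟨(t, y), h⟩ (timeDeriv S (hG.alg.g i j))) t :=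
  hasDerivAt_evalAt h _ fun _ hs => hG.g_eq hs i j

theorem timeDeriv_comm (i : Fin n) (f : smoothFun S) :
    timeDeriv S (hG.alg.d i f) = hG.alg.d i (timeDeriv S f) := dirDeriv_comm _ _ f

theorem d_algebraMap (i : Fin n) (r : ℝ) :
    hG.alg.d i (algebraMap ℝ (smoothFun S) r) = 0 := Derivation.map_algebraMap _ _

variable {α β : ℝ} (hf : IsLocalFlow α β S G)
include hf

include h in
theorem hasDerivAt_coeff_flow (hG : IsMetricOn S G) (i j : Fin n) :
    HasDerivAt (fun s => G s y i j)
      (-(2 * α * ricci (G t) i j y) - β * scalarCurv (G t) y * G t y i j) t := by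
  have h1 := (hG.hasDerivAt_coeff h i j).differentiableAt.hasDerivAt
  refine h1.congr_deriv ?_
  linear_combination hf t y h i j

theorem timeDeriv_metric (i j : Fin n) : timeDeriv S (hG.alg.g i j)
    = -(2 * algebraMap ℝ (smoothFun S) α * hG.alg.ric i j)
      - algebraMap ℝ (smoothFun S) β * hG.alg.scal * hG.alg.g i j := by
  ext ⟨⟨t, y⟩, h⟩
  have h1 := (hG.hasDerivAt_coeff h i j).unique (hG.hasDerivAt_coeff_flow h hf i j)
  rw [← evalAt_apply, ← evalAt_apply, h1, hG.ricci_eq h, hG.scalarCurv_eq h, hG.g_eq h]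
  simp only [map_sub, map_neg, map_mul, map_ofNat, AlgHom.commutes]
  rfl

include h

theorem hasDerivAt_christoffel (hG : IsMetricOn S G) (k i j : Fin n) :
    HasDerivAt (fun s => christoffel (G s) k i j y)
      (α * ∑ l, (G t y)⁻¹ k l *
            (covDeriv (G t) (ricci (G t)) l i j y
              - covDeriv (G t) (ricci (G t)) i j l y
              - covDeriv (G t) (ricci (G t)) j i l y)
          - β / 2 *
            (pd (scalarCurv (G t)) i y * (1 : Matrix (Fin n) (Fin n) ℝ) k j
              + pd (scalarCurv (G t)) j y * (1 : Matrix (Fin n) (Fin n) ℝ) k i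
              - gradUp (G t) (scalarCurv (G t)) k y * G t y i j)) t := by
  have h1 := hasDerivAt_evalAt h _ fun _ hs => hG.christoffel_eq hs k i j
  convert h1 using 1
  have h2 := hG.alg.D_chr (timeDeriv S) hG.timeDeriv_comm (hG.d_algebraMap · α)
    (hG.d_algebraMap · β) (hG.timeDeriv_metric hf) k i j
  have hone : ∀ a b, evalAt ⟨(t, y), h⟩ ((1 : Matrix (Fin n) (Fin n) (smoothFun S)) a b)
      = (1 : Matrix (Fin n) (Fin n) ℝ) a b := by
    intro a b
    simp only [Matrix.one_apply, apply_ite (evalAt (S := S) ⟨(t, y), h⟩), map_one, map_zero]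
  change _ = evalAt ⟨(t, y), h⟩ (timeDeriv S _)
  rw [h2]
  simp only [map_sub, map_add, map_mul, map_sum, AlgHom.commutes, hone, half_eq,
    ← hG.H_eq h, ← hG.covDeriv_ricci_eq h, ← hG.pd_scalarCurv_eq h, ← hG.gradUp_scalarCurv_eq h,
    ← hG.g_eq h]
  simp only [Algebra.algebraMap_self, RingHom.id_apply]
  ring

theorem hasDerivAt_scalarCurv (hG : IsMetricOn S G) :
    HasDerivAt (fun s => scalarCurv (G s) y)
      ((α + ((n : ℝ) - 1) * β) * laplacian (G t) (scalarCurv (G t)) y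
        + 2 * α * ricciNormSq (G t) y + β * scalarCurv (G t) y ^ 2) t := by
  have h1 := hasDerivAt_evalAt h _ fun _ hs => hG.scalarCurv_eq hs
  convert h1 using 1
  have h2 := hG.alg.D_scal_flow (timeDeriv S) hG.timeDeriv_comm (hG.d_algebraMap · α)
    (hG.d_algebraMap · β) (hG.timeDeriv_metric hf)
  change _ = evalAt ⟨(t, y), h⟩ (timeDeriv S _)
  rw [h2]
  simp only [map_sub, map_add, map_mul, map_pow, AlgHom.commutes, map_natCast, map_ofNat, map_one,
    ← hG.scalarCurv_eq h, ← hG.laplacian_scalarCurv_eq h, ← hG.ricciNormSq_eq h, Fintype.card_fin]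
  simp only [Algebra.algebraMap_self, RingHom.id_apply]

/-- By Jacobi's formula the logarithmic derivative is tr(g⁻¹∂ₜg), with tr(g⁻¹Ric) = R and tr(g⁻¹g) =
n. -/
theorem hasDerivAt_det_flow (hG : IsMetricOn S G) :
    HasDerivAt (fun s => (G s y).det)
      (-(2 * α + n * β) * scalarCurv (G t) y * (G t y).det) t := by
  have hu : IsUnit (G t y).det := (hG.det_ne _ h).isUnit
  have h1 := hasDerivAt_det (G := fun s => G s y)
    (G' := -((2 * α) • Matrix.of fun i j => ricci (G t) i j y) - (β * scalarCurv (G t) y) • G t y)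
    fun i j => by simpa using hG.hasDerivAt_coeff_flow h hf i j
  convert h1 using 1
  have h2 : (G t y).adjugate = (G t y).det • (G t y)⁻¹ := by
    rw [Matrix.inv_def, smul_smul, Ring.mul_inverse_cancel _ hu, one_smul]
  have h3 : ((G t y)⁻¹ * Matrix.of fun i j => ricci (G t) i j y).trace = scalarCurv (G t) y := by
    simp only [Matrix.trace, Matrix.diag, Matrix.mul_apply, Matrix.of_apply, scalarCurv]
    refine Finset.sum_congr rfl fun i _ => Finset.sum_congr rfl fun j _ => ?_
    rw [hG.ricci_eq h, hG.ricci_eq h, hG.alg.ric_symm]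
  rw [h2, mul_sub, mul_neg, Matrix.trace_sub, Matrix.trace_neg, Matrix.mul_smul, Matrix.mul_smul,
    Matrix.smul_mul, Matrix.smul_mul, Matrix.nonsing_inv_mul _ hu]
  simp only [Matrix.trace_smul, h3, smul_eq_mul, Matrix.trace_one, Fintype.card_fin]
  ring

theorem hasDerivAt_volDensity (hG : IsMetricOn S G) (hpos : 0 < (G t y).det) :
    HasDerivAt (fun s => volDensity (G s) y)
      (-(α + (n : ℝ) / 2 * β) * scalarCurv (G t) y * volDensity (G t) y) t := by
  have h1 := (hG.hasDerivAt_det_flow h hf).sqrt hpos.ne'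
  refine h1.congr_deriv ?_
  change _ = _ * Real.sqrt (G t y).det
  have h2 := Real.sqrt_ne_zero'.mpr hpos
  have h3 := Real.sq_sqrt hpos.le
  field_simp
  linear_combination (2 * α + n * β) * scalarCurv (G t) y * h3

end IsMetricOn

/-! ### Curvature evolution on surfaces -/

namespace IsMetricOn

variable {S : Opens (ℝ × Coord 2)} {G : ℝ → Coord 2 → Matrix (Fin 2) (Fin 2) ℝ}
  (hG : IsMetricOn S G) {t : ℝ} {y : Coord 2} (h : (t, y) ∈ S)
include hG h

theorem ricciNormSq_surface : ricciNormSq (G t) y = scalarCurv (G t) y ^ 2 / 2 := by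
  have h1 := congrArg (evalAt ⟨(t, y), h⟩) hG.alg.normSq_surface
  rw [map_mul, map_pow, ← hG.ricciNormSq_eq h, ← hG.scalarCurv_eq h, map_ofNat] at h1
  linarith

theorem gaussCurv_surface (hn : 2 = 2) : gaussCurv hn (G t) y = scalarCurv (G t) y / 2 := by
  have h1 := congrArg (evalAt ⟨(t, y), h⟩) hG.alg.scal_surface
  have hd := hG.det_ne _ h
  rw [Matrix.det_fin_two] at hd
  simp only [MetricAlgebra.rho, map_mul, map_sub, map_pow, map_sum, map_ofNat, ← hG.g_eq h,
    ← hG.riemann_eq h, ← hG.scalarCurv_eq h] at h1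
  have hd' : G t y 0 0 * G t y 1 1 - G t y 0 1 ^ 2 ≠ 0 := by
    rw [hG.symm t y 1 0] at hd
    rwa [sq]
  change (∑ m, G t y 0 m * riemann (G t) m 0 1 1 y) / (G t y 0 0 * G t y 1 1 - G t y 0 1 ^ 2) = _
  rw [div_eq_iff hd']
  linarith

variable {α β : ℝ} (hf : IsLocalFlow α β S G)
include hf

theorem hasDerivAt_scalarCurv_surface :
    HasDerivAt (fun s => scalarCurv (G s) y)
      ((α + β) * (laplacian (G t) (scalarCurv (G t)) y + scalarCurv (G t) y ^ 2)) t := by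
  convert hG.hasDerivAt_scalarCurv h hf using 1
  rw [hG.ricciNormSq_surface h]
  push_cast
  ring

-- K = R/2 holds only on the chart domain, so each of the two differentiations goes through `pd_eq`
-- on a time slice.
omit hf in
theorem laplacian_gaussCurv (hn : 2 = 2) : laplacian (G t) (gaussCurv hn (G t)) y
    = laplacian (G t) (scalarCurv (G t)) y / 2 := by
  have hc : ∀ z, (t, z) ∈ S → ∀ j, pd (gaussCurv hn (G t)) j z
      = pd (scalarCurv (G t)) j z / 2 := by
    intro z hz j
    have e : pd (gaussCurv hn (G t)) j z = _ := pd_eq hz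
      (algebraMap ℝ (smoothFun S) (1 / 2) * hG.alg.scal) (fun w hw => by
        rw [hG.gaussCurv_surface hw, map_mul, AlgHom.commutes, ← hG.scalarCurv_eq hw]
        simp only [Algebra.algebraMap_self, RingHom.id_apply]
        ring) j
    rw [e, hG.pd_scalarCurv_eq hz, Derivation.leibniz, Derivation.map_algebraMap, smul_zero,
      add_zero, smul_eq_mul, map_mul, AlgHom.commutes]
    simp only [Algebra.algebraMap_self, RingHom.id_apply]
    change _ * evalAt _ (hG.alg.d j _) = _
    ring
  have hc2 : ∀ i j, pd (pd (gaussCurv hn (G t)) j) i y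
      = pd (pd (scalarCurv (G t)) j) i y / 2 := by
    intro i j
    have e1 : pd (pd (gaussCurv hn (G t)) j) i y = _ := pd_eq h
      (algebraMap ℝ (smoothFun S) (1 / 2) * hG.alg.d j hG.alg.scal) (fun w hw => by
        rw [hc w hw, map_mul, AlgHom.commutes, ← hG.pd_scalarCurv_eq hw]
        simp only [Algebra.algebraMap_self, RingHom.id_apply]
        ring) i
    have e2 : pd (pd (scalarCurv (G t)) j) i y = _ :=
      pd_eq h (hG.alg.d j hG.alg.scal) (fun w hw => hG.pd_scalarCurv_eq hw j) i
    rw [e1, e2, Derivation.leibniz, Derivation.map_algebraMap, smul_zero,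
      add_zero, smul_eq_mul, map_mul, AlgHom.commutes]
    simp only [Algebra.algebraMap_self, RingHom.id_apply]
    ring
  simp only [laplacian, hc y h, hc2, Finset.sum_div]
  refine Finset.sum_congr rfl fun i _ => Finset.sum_congr rfl fun j _ => ?_
  rw [mul_div_assoc, sub_div, Finset.sum_div]
  simp only [mul_div_assoc]

theorem hasDerivAt_gaussCurv (hn : 2 = 2) :
    HasDerivAt (fun s => gaussCurv hn (G s) y)
      ((α + β) * (laplacian (G t) (gaussCurv hn (G t)) y + 2 * gaussCurv hn (G t) y ^ 2)) t := by
  have hcont : Continuous fun s : ℝ => (s, y) := by fun_prop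
  have h1 := (hG.hasDerivAt_scalarCurv_surface h hf).div_const 2
  have hev : (fun s => gaussCurv hn (G s) y) =ᶠ[𝓝 t] fun s => scalarCurv (G s) y / 2 := by
    filter_upwards [(S.isOpen.preimage hcont).mem_nhds h] with s hs
    exact hG.gaussCurv_surface hs hn
  refine (h1.congr_of_eventuallyEq hev).congr_deriv ?_
  rw [hG.laplacian_gaussCurv h, hG.gaussCurv_surface h]
  ring

end IsMetricOn

/-! ### The second derivative test for the Laplacian -/

/-- A negative second derivative would make the point a local maximum as well, so f would be locally
constant. -/
theorem second_deriv_nonneg_of_isLocalMin {f : ℝ → ℝ} {a : ℝ} (h : IsLocalMin f a)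
    (hc : ContinuousAt f a) : 0 ≤ deriv (deriv f) a := by
  by_contra! hneg
  have hmax := isLocalMax_of_deriv_deriv_neg hneg h.deriv_eq_zero hc
  have hconst : f =ᶠ[𝓝 a] fun _ => f a := by
    filter_upwards [h, hmax] with x h1 h2 using le_antisymm h2 h1
  rw [hconst.deriv.deriv_eq] at hneg
  simp at hneg

variable {n : ℕ}

theorem sum_smul_single (v : Fin n → ℝ) :
    WithLp.toLp 2 v = ∑ i, v i • (EuclideanSpace.single i 1 : Coord n) := by
  ext j
  simp [Pi.single_apply]

/-- Restrict u to the line through y in direction v and apply the one-variable test. -/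
theorem hessian_nonneg_of_isLocalMin {u : Coord n → ℝ} {y : Coord n} (hu : ContDiffAt ℝ 2 u y)
    (h : IsLocalMin u y) (v : Fin n → ℝ) : 0 ≤ ∑ i, ∑ j, v i * v j * pd (pd u j) i y := by
  set w : Coord n := WithLp.toLp 2 v with hw
  have hline : ∀ r : ℝ, HasDerivAt (fun r : ℝ => y + r • w) w r := fun r => by
    simpa using ((hasDerivAt_id r).smul_const w).const_add y
  have hy0 : y + (0 : ℝ) • w = y := by simp
  have htend : Tendsto (fun r : ℝ => y + r • w) (𝓝 0) (𝓝 y) := by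
    have := (hline 0).continuousAt.tendsto
    rwa [hy0] at this
  have hu1 : ∀ᶠ z in 𝓝 y, DifferentiableAt ℝ u z :=
    (hu.eventually (by simp)).mono fun z hz => hz.differentiableAt (by simp)
  have hd1 : ∀ᶠ r in 𝓝 (0 : ℝ), deriv (fun r : ℝ => u (y + r • w)) r = fderiv ℝ u (y + r • w) w := by
    filter_upwards [htend.eventually hu1] with r hr
    exact (hr.hasFDerivAt.comp_hasDerivAt r (hline r)).deriv
  have hf2 : DifferentiableAt ℝ (fderiv ℝ u) y :=
    (hu.fderiv_right (m := 1) (by norm_num)).differentiableAt (by simp)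
  have hd2 : deriv (deriv fun r : ℝ => u (y + r • w)) 0 = fderiv ℝ (fderiv ℝ u) y w w := by
    rw [EventuallyEq.deriv_eq hd1]
    have h1 : HasFDerivAt (fderiv ℝ u) (fderiv ℝ (fderiv ℝ u) y) (y + (0 : ℝ) • w) := by
      rw [hy0]; exact hf2.hasFDerivAt
    have h2 : HasDerivAt (fun r : ℝ => fderiv ℝ u (y + r • w)) (fderiv ℝ (fderiv ℝ u) y w) 0 :=
      HasFDerivAt.comp_hasDerivAt (f := fun r : ℝ => y + r • w) (0 : ℝ) h1 (hline 0)
    have h3 : HasDerivAt (fun r : ℝ => fderiv ℝ u (y + r • w) w)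
        (fderiv ℝ (fderiv ℝ u) y w w) 0 := by
      simpa using h2.clm_apply (hasDerivAt_const (0 : ℝ) w)
    exact h3.deriv
  have hmin : IsLocalMin (fun r : ℝ => u (y + r • w)) 0 := by
    have := htend.eventually h
    simpa [IsLocalMin, IsMinFilter] using this
  have hc : ContinuousAt (fun r : ℝ => u (y + r • w)) 0 := by
    have h1 : ContinuousAt u (y + (0 : ℝ) • w) := by rw [hy0]; exact hu.continuousAt
    exact h1.comp (f := fun r : ℝ => y + r • w) (hline 0).continuousAt
  have key := second_deriv_nonneg_of_isLocalMin hmin hc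
  rw [hd2, hw, sum_smul_single] at key
  have hpd : ∀ i j, pd (pd u j) i y = fderiv ℝ (fderiv ℝ u) y (EuclideanSpace.single i 1)
      (EuclideanSpace.single j 1) := by
    intro i j
    change fderiv ℝ (fun z => fderiv ℝ u z (EuclideanSpace.single j 1)) y _ = _
    rw [fderiv_clm_apply hf2 (differentiableAt_const _)]
    simp
  simp only [map_sum, map_smul, _root_.sum_apply, _root_.smul_apply,
    smul_eq_mul, Finset.mul_sum] at key
  rw [Finset.sum_comm] at key
  refine key.trans_eq (Finset.sum_congr rfl fun i _ => Finset.sum_congr rfl fun j _ => ?_)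
  rw [hpd]
  ring

/-- At a minimum the first-order terms vanish and Δu = tr(g⁻¹ Hess u), a trace of a product of a
positive definite and a positive semidefinite matrix. -/
theorem laplacian_nonneg_of_isLocalMin {G : Coord n → Matrix (Fin n) (Fin n) ℝ} {u : Coord n → ℝ}
    {y : Coord n} (hG : (G y).PosDef) (hu : ContDiffAt ℝ 2 u y) (h : IsLocalMin u y) :
    0 ≤ laplacian G u y := by
  have h0 : ∀ k, pd u k y = 0 := fun k => by
    rw [pd, h.fderiv_eq_zero]; rfl
  have hf2 : DifferentiableAt ℝ (fderiv ℝ u) y :=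
    (hu.fderiv_right (m := 1) (by norm_num)).differentiableAt (by simp)
  have hpd : ∀ i j, pd (pd u j) i y = fderiv ℝ (fderiv ℝ u) y (EuclideanSpace.single i 1)
      (EuclideanSpace.single j 1) := by
    intro i j
    change fderiv ℝ (fun z => fderiv ℝ u z (EuclideanSpace.single j 1)) y _ = _
    rw [fderiv_clm_apply hf2 (differentiableAt_const _)]
    simp
  have hsymm : ∀ i j, pd (pd u j) i y = pd (pd u i) j y := fun i j => by
    rw [hpd, hpd]
    exact (hu.isSymmSndFDerivAt (by rw [minSmoothness_of_isRCLikeNormedField])) _ _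
  have hpsd : (Matrix.of fun i j => pd (pd u j) i y).PosSemidef := by
    refine Matrix.PosSemidef.of_dotProduct_mulVec_nonneg ?_ fun v => ?_
    · ext i j
      simp [hsymm i j]
    · have := hessian_nonneg_of_isLocalMin hu h v
      simp only [dotProduct, Matrix.mulVec, Matrix.of_apply, star_trivial, Finset.mul_sum]
      refine this.trans_eq (Finset.sum_congr rfl fun i _ => Finset.sum_congr rfl fun j _ => ?_)
      ring
  -- The trace is the sum of the entries of the Hadamard product, which is positive semidefinite by
  -- Schur; test it on the all-ones vector.
  have := (hG.inv.posSemidef.hadamard hpsd).dotProduct_mulVec_nonneg fun _ => (1 : ℝ)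
  simp only [dotProduct, Matrix.mulVec, Matrix.hadamard_apply, Matrix.of_apply, star_trivial,
    Pi.star_apply, one_mul, mul_one] at this
  simpa only [laplacian, h0, mul_zero, Finset.sum_const_zero, sub_zero] using this

/-! ### Metric coefficients in charts -/

section Charts

variable {M : Type*} [TopologicalSpace M] [ChartedSpace (Coord n) M] [IsManifold (𝓡 n) ∞ M]

/-- The Gram matrix of a frame at a point. -/
noncomputable def gram (g : Metric n M) (x : M) (V : Fin n → TangentSpace (𝓡 n) x) :
    Matrix (Fin n) (Fin n) ℝ :=
  Matrix.of fun i j => g.inner x (V i) (V j)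

theorem gram_sum (g : Metric n M) (x : M) (V : Fin n → TangentSpace (𝓡 n) x)
    (J : Matrix (Fin n) (Fin n) ℝ) :
    gram g x (fun i => ∑ k, J k i • V k) = Jᵀ * gram g x V * J := by
  ext i j
  simp only [gram, Matrix.of_apply, Matrix.mul_apply, Matrix.transpose_apply, Finset.sum_mul,
    map_sum, map_smul]
  refine Finset.sum_congr rfl fun l _ => ?_
  rw [_root_.sum_apply, Finset.smul_sum]
  refine Finset.sum_congr rfl fun k _ => ?_
  rw [_root_.smul_apply, smul_eq_mul, smul_eq_mul]
  ring

theorem map_eq_sum {F : Type*} [AddCommGroup F] [Module ℝ F] (L : Coord n →ₗ[ℝ] F) (v : Coord n) :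
    L v = ∑ k, v k • L (EuclideanSpace.single k 1) := by
  conv_lhs => rw [← WithLp.toLp_ofLp 2 v, sum_smul_single v.ofLp]
  simp

omit [IsManifold (𝓡 n) ∞ M] in
theorem mdifferentiable_of_mem_charts {φ : OpenPartialHomeomorph M (Coord n)}
    (hφ : φ ∈ charts n M) : φ.MDifferentiable (𝓡 n) (𝓡 n) :=
  ⟨(contMDiffOn_of_mem_maximalAtlas hφ).mdifferentiableOn (by simp),
    (contMDiffOn_symm_of_mem_maximalAtlas hφ).mdifferentiableOn (by simp)⟩

omit [IsManifold (𝓡 n) ∞ M] in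
theorem bijective_mfderiv_symm {φ : OpenPartialHomeomorph M (Coord n)} (hφ : φ ∈ charts n M)
    {y : Coord n} (hy : y ∈ φ.target) :
    Function.Bijective (mfderiv (𝓡 n) (𝓡 n) φ.symm y) :=
  (mdifferentiable_of_mem_charts hφ).symm.mfderiv_bijective hy

theorem coeff_symm (g : Metric n M) (φ : OpenPartialHomeomorph M (Coord n)) (y : Coord n)
    (i j : Fin n) : coeff g φ y i j = coeff g φ y j i := g.symm _ _ _

omit [IsManifold (𝓡 n) ∞ M] in
theorem coordVec_sum (φ : OpenPartialHomeomorph M (Coord n)) (y v : Coord n) :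
    mfderiv (𝓡 n) (𝓡 n) φ.symm y v = ∑ k, v k • coordVec φ k y :=
  map_eq_sum (mfderiv (𝓡 n) (𝓡 n) φ.symm y).toLinearMap v

theorem posDef_coeff (g : Metric n M) {φ : OpenPartialHomeomorph M (Coord n)} (hφ : φ ∈ charts n M)
    {y : Coord n} (hy : y ∈ φ.target) : (coeff g φ y).PosDef := by
  refine Matrix.PosDef.of_dotProduct_mulVec_pos ?_ fun v hv => ?_
  · ext i j
    simp [coeff_symm g φ y i j]
  · have hne : mfderiv (𝓡 n) (𝓡 n) φ.symm y (WithLp.toLp 2 v) ≠ 0 := by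
      intro h0
      have := (bijective_mfderiv_symm hφ hy).1 (h0.trans (map_zero _).symm)
      exact hv (congrArg WithLp.ofLp this)
    have hpos := g.pos _ _ hne
    rw [coordVec_sum] at hpos
    simp only [map_sum, map_smul, _root_.sum_apply, _root_.smul_apply,
      smul_eq_mul] at hpos
    simp only [dotProduct, Matrix.mulVec, star_trivial, Finset.mul_sum, coeff, Matrix.of_apply]
    refine hpos.trans_eq (Finset.sum_congr rfl fun i _ => ?_)
    rw [Finset.mul_sum]
    refine Finset.sum_congr rfl fun j _ => ?_
    rw [g.symm]
    ring

/-- The change of frame J is found before the metric is named, so one J serves all times. Keeping x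
= x' as a hypothesis lets substitution identify the two tangent spaces. -/
theorem exists_gram_eq {x x' : M} (hx : x = x') (V : Fin n → TangentSpace (𝓡 n) x)
    (V' : Fin n → TangentSpace (𝓡 n) x') (hV' : ∀ v, ∃ c : Fin n → ℝ, v = ∑ k, c k • V' k) :
    ∃ J : Matrix (Fin n) (Fin n) ℝ, ∀ g : Metric n M, gram g x V = Jᵀ * gram g x' V' * J := by
  subst hx
  choose c hc using fun i => hV' (V i)
  refine ⟨Matrix.of fun k i => c i k, fun g => ?_⟩
  rw [← gram_sum]
  congr 1
  funext i
  exact hc i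

/-- Under a change of charts the metric coefficients transform by a matrix which does not depend on
the metric. -/
theorem exists_coeff_eq {φ φ' : OpenPartialHomeomorph M (Coord n)}
    (hφ' : φ' ∈ charts n M) {y y' : Coord n} (hy' : y' ∈ φ'.target)
    (hx : φ.symm y = φ'.symm y') : ∃ J : Matrix (Fin n) (Fin n) ℝ,
      ∀ g : Metric n M, coeff g φ y = Jᵀ * coeff g φ' y' * J := by
  refine exists_gram_eq hx (fun i => coordVec φ i y) (fun i => coordVec φ' i y') fun v => ?_
  obtain ⟨w, rfl⟩ := (bijective_mfderiv_symm hφ' hy').2 v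
  exact ⟨WithLp.ofLp (p := 2) (V := Fin n → ℝ) w, coordVec_sum φ' y' w⟩

end Charts

/-! ### The flow in charts: invariance of R and constancy of volume -/

section Flow

variable {n : ℕ} {M : Type*} [TopologicalSpace M] [ChartedSpace (Coord n) M]
  [IsManifold (𝓡 n) ∞ M]

/-- The space-time domain of a chart. -/
def chartDomain {I : Set ℝ} (hI : IsOpen I) (φ : OpenPartialHomeomorph M (Coord n)) :
    Opens (ℝ × Coord n) :=
  ⟨I ×ˢ φ.target, hI.prod φ.open_target⟩

variable {I : Set ℝ} (hI : IsOpen I) {α β : ℝ} {g : ℝ → Metric n M}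
  (hg : IsRicciYamabeFlow α β I g) {φ : OpenPartialHomeomorph M (Coord n)} (hφ : φ ∈ charts n M)
include hg hφ

theorem isMetricOn_coeff : IsMetricOn (chartDomain hI φ) fun s => coeff (g s) φ where
  smooth := hg.1 φ hφ
  symm s := coeff_symm (g s) φ
  det_ne p hp := (posDef_coeff (g p.1) hφ hp.2).det_pos.ne'

theorem isLocalFlow_coeff : IsLocalFlow α β (chartDomain hI φ) fun s => coeff (g s) φ :=
  fun t y h i j => hg.2 t h.1 φ hφ y h.2 i j

-- The two determinants differ by (det J)², constant in time, so their logarithmic derivatives −(2α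
-- + nβ)R agree. This replaces the transformation law of the curvature tensor.
include hI in
theorem scalarCurv_chart_eq (hαβ : 2 * α + n * β ≠ 0)
    {φ' : OpenPartialHomeomorph M (Coord n)} (hφ' : φ' ∈ charts n M)
    {y y' : Coord n} (hy : y ∈ φ.target) (hy' : y' ∈ φ'.target) (hx : φ.symm y = φ'.symm y')
    {t : ℝ} (ht : t ∈ I) :
    scalarCurv (coeff (g t) φ) y = scalarCurv (coeff (g t) φ') y' := by
  obtain ⟨J, hJ⟩ := exists_coeff_eq (φ := φ) hφ' hy' hx
  have h1 := IsMetricOn.hasDerivAt_det_flow (S := chartDomain hI φ) (t := t) (y := y) ⟨ht, hy⟩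
    (isLocalFlow_coeff hI hg hφ) (isMetricOn_coeff hI hg hφ)
  have h2 := IsMetricOn.hasDerivAt_det_flow (S := chartDomain hI φ') (t := t) (y := y') ⟨ht, hy'⟩
    (isLocalFlow_coeff hI hg hφ') (isMetricOn_coeff hI hg hφ')
  have hdet : ∀ s, (coeff (g s) φ y).det = J.det ^ 2 * (coeff (g s) φ' y').det := by
    intro s
    rw [hJ, Matrix.det_mul, Matrix.det_mul, Matrix.det_transpose]
    ring
  have hpos := (posDef_coeff (g t) hφ hy).det_pos
  have h3 := h2.const_mul (J.det ^ 2)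
  simp only [← hdet] at h3
  have h4 := h1.unique h3
  have h5 : (2 * α + n * β) * (coeff (g t) φ y).det
      * (scalarCurv (coeff (g t) φ) y - scalarCurv (coeff (g t) φ') y') = 0 := by
    linear_combination -h4 + (2 * α + n * β) * scalarCurv (coeff (g t) φ') y' * (-hdet t)
  rcases mul_eq_zero.mp h5 with h6 | h6
  · exact absurd h6 (mul_ne_zero hαβ hpos.ne')
  · linarith

-- Each chart density has zero time derivative on the interval I, so every measure in the supremum
-- is constant; no change of variables between charts is needed.
omit hφ in
theorem volumeMeasure_eq [MeasurableSpace M] [BorelSpace M] (hI : IsOpen I)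
    (hI' : I.OrdConnected) (hαβ : 2 * α + n * β = 0) {s t : ℝ} (hs : s ∈ I) (ht : t ∈ I) :
    volumeMeasure (g s) = volumeMeasure (g t) := by
  unfold volumeMeasure
  refine iSup_congr fun φ => iSup_congr fun hφ => ?_
  unfold chartVolume
  congr 1
  refine MeasureTheory.withDensity_congr_ae ?_
  refine MeasureTheory.ae_restrict_of_forall_mem φ.open_target.measurableSet fun y hy => ?_
  have hd : ∀ r ∈ I, HasDerivAt (fun r => volDensity (coeff (g r) φ) y) 0 r := fun r hr => by
    refine (IsMetricOn.hasDerivAt_volDensity (S := chartDomain hI φ) (t := r) (y := y) ⟨hr, hy⟩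
      (isLocalFlow_coeff hI hg hφ) (isMetricOn_coeff hI hg hφ) (posDef_coeff (g r) hφ hy).det_pos).congr_deriv ?_
    have : α + (n : ℝ) / 2 * β = 0 := by linarith
    rw [this]; ring
  have := hI.is_const_of_deriv_eq_zero hI'.isPreconnected
    (fun r hr => (hd r hr).differentiableAt.differentiableWithinAt) (fun r hr => (hd r hr).deriv)
    hs ht
  exact congrArg ENNReal.ofReal this

end Flow

/-! ### Minimum principle on closed surfaces -/

section Surface

variable {M : Type*} [TopologicalSpace M] [ChartedSpace (Coord 2) M] [IsManifold (𝓡 2) ∞ M]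
  {I : Set ℝ} {α β : ℝ} {g : ℝ → Metric 2 M}

/-- The scalar curvature as a function on the manifold. -/
noncomputable def scalarOn (g : Metric 2 M) (x : M) : ℝ :=
  scalarCurv (coeff g (chartAt (Coord 2) x)) (chartAt (Coord 2) x x)

theorem scalarOn_eq (hI : IsOpen I) (hg : IsRicciYamabeFlow α β I g) (hαβ : α + β ≠ 0)
    {φ : OpenPartialHomeomorph M (Coord 2)} (hφ : φ ∈ charts 2 M) {y : Coord 2}
    (hy : y ∈ φ.target) {t : ℝ} (ht : t ∈ I) :
    scalarOn (g t) (φ.symm y) = scalarCurv (coeff (g t) φ) y := by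
  refine scalarCurv_chart_eq hI hg (IsManifold.chart_mem_maximalAtlas _) ?_ hφ
    (OpenPartialHomeomorph.map_source _ (mem_chart_source _ _)) hy
    (OpenPartialHomeomorph.left_inv _ (mem_chart_source _ _)) ht
  intro h
  push_cast at h
  exact hαβ (by linarith)

/-- Although `scalarOn` uses a chart depending on the point, chart independence lets one fixed chart
compute it near (t, x). -/
theorem continuousOn_scalarOn (hI : IsOpen I) (hg : IsRicciYamabeFlow α β I g)
    (hαβ : α + β ≠ 0) :
    ContinuousOn (fun p : ℝ × M => scalarOn (g p.1) p.2) (I ×ˢ Set.univ) := by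
  rintro ⟨t, x⟩ ⟨ht, -⟩
  refine ContinuousAt.continuousWithinAt ?_
  set φ := chartAt (Coord 2) x with hφdef
  have hφ : φ ∈ charts 2 M := IsManifold.chart_mem_maximalAtlas _
  have hx : x ∈ φ.source := mem_chart_source _ _
  have hG := isMetricOn_coeff hI hg hφ
  have hev : (fun p : ℝ × M => scalarOn (g p.1) p.2) =ᶠ[𝓝 (t, x)]
      fun p => smoothExt hG.alg.scal (p.1, φ p.2) := by
    filter_upwards [(hI.prod φ.open_source).mem_nhds (x := (t, x)) ⟨ht, hx⟩] with p hp
    have h1 := scalarOn_eq hI hg hαβ hφ (φ.map_source hp.2) hp.1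
    have h2 : (p.1, φ p.2) ∈ chartDomain hI φ := ⟨hp.1, φ.map_source hp.2⟩
    rw [φ.left_inv hp.2, hG.scalarCurv_eq h2, evalAt_apply, ← smoothExt_apply] at h1
    exact h1
  refine ContinuousAt.congr ?_ hev.symm
  have h2 : (t, φ x) ∈ chartDomain hI φ := ⟨ht, φ.map_source hx⟩
  have hc : ContinuousAt (smoothExt hG.alg.scal) (t, φ x) :=
    (differentiableAt_smoothExt hG.alg.scal ⟨_, h2⟩).continuousAt
  exact ContinuousAt.comp (f := fun p : ℝ × M => (p.1, φ p.2)) hc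
    (continuousAt_fst.prodMk ((φ.continuousAt hx).comp continuousAt_snd))

theorem contDiffAt_scalarCurv {S : Opens (ℝ × Coord 2)}
    {G : ℝ → Coord 2 → Matrix (Fin 2) (Fin 2) ℝ} (hG : IsMetricOn S G) {t : ℝ} {y : Coord 2}
    (h : (t, y) ∈ S) : ContDiffAt ℝ 2 (scalarCurv (G t)) y := by
  have hcont : Continuous fun z : Coord 2 => (t, z) := by fun_prop
  have hev : scalarCurv (G t) =ᶠ[𝓝 y] fun z => smoothExt hG.alg.scal (t, z) := by
    filter_upwards [(S.isOpen.preimage hcont).mem_nhds h] with z hz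
    rw [hG.scalarCurv_eq hz, evalAt_apply, ← smoothExt_apply]
  refine ContDiffAt.congr_of_eventuallyEq ?_ hev
  exact ((contDiffAt_smoothExt hG.alg.scal ⟨(t, y), h⟩).of_le (by norm_cast)).comp
    (f := fun z : Coord 2 => (t, z)) y (contDiffAt_const.prodMk contDiffAt_id)

/-- The lower bound for the scalar curvature, starting from an interior time `ε`. -/
theorem scalarOn_ge_of_compact [CompactSpace M] (hI : IsOpen I) (hg : IsRicciYamabeFlow α β I g)
    (hαβ : 0 < α + β) {ε t : ℝ} (hεt : ε < t) (hsub : Set.Icc ε t ⊆ I) (x : M) :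
    -(1 / (α + β)) ≤ (t - ε) * scalarOn (g t) x := by
  by_contra! hlt
  set c := α + β with hc
  have hcont : ContinuousOn (fun p : ℝ × M => (p.1 - ε) * scalarOn (g p.1) p.2)
      (Set.Icc ε t ×ˢ Set.univ) :=
    ((continuous_fst.sub continuous_const).continuousOn).mul
      ((continuousOn_scalarOn hI hg hαβ.ne').mono (Set.prod_mono hsub le_rfl))
  obtain ⟨⟨s, z⟩, ⟨hs, -⟩, hmin⟩ := (isCompact_Icc.prod isCompact_univ).exists_isMinOn
    ⟨(t, x), ⟨hεt.le, le_rfl⟩, trivial⟩ hcont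
  have hw : (s - ε) * scalarOn (g s) z < -(1 / c) :=
    (hmin (show (t, x) ∈ _ from ⟨⟨hεt.le, le_rfl⟩, trivial⟩)).trans_lt hlt
  -- The function vanishes at time ε, so a negative minimum occurs later.
  have hεs : ε < s := by
    refine lt_of_le_of_ne hs.1 fun he => ?_
    rw [← he, sub_self, zero_mul] at hw
    have : 0 < 1 / c := by positivity
    linarith
  have hsI : s ∈ I := hsub hs
  set φ := chartAt (Coord 2) z with hφdef
  have hφ : φ ∈ charts 2 M := IsManifold.chart_mem_maximalAtlas _
  have hz : z ∈ φ.source := mem_chart_source _ _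
  have hG := isMetricOn_coeff hI hg hφ
  have hy : φ z ∈ φ.target := φ.map_source hz
  have hS : (s, φ z) ∈ chartDomain hI φ := ⟨hsI, hy⟩
  have heq : ∀ r ∈ I, ∀ y ∈ φ.target,
      scalarOn (g r) (φ.symm y) = scalarCurv (coeff (g r) φ) y :=
    fun r hr y hy => scalarOn_eq hI hg hαβ.ne' hφ hy hr
  have hval : scalarOn (g s) z = scalarCurv (coeff (g s) φ) (φ z) := by
    rw [← heq s hsI _ hy, φ.left_inv hz]
  have hmin' : ∀ r ∈ Set.Icc ε t, ∀ y ∈ φ.target,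
      (s - ε) * scalarCurv (coeff (g s) φ) (φ z) ≤ (r - ε) * scalarCurv (coeff (g r) φ) y := by
    intro r hr y hy
    rw [← hval, ← heq r (hsub hr) y hy]
    exact hmin (show (r, φ.symm y) ∈ _ from ⟨hr, trivial⟩)
  have hlap : 0 ≤ laplacian (coeff (g s) φ) (scalarCurv (coeff (g s) φ)) (φ z) := by
    refine laplacian_nonneg_of_isLocalMin (posDef_coeff (g s) hφ hy)
      (contDiffAt_scalarCurv hG hS) ?_
    filter_upwards [φ.open_target.mem_nhds hy] with y hy'
    exact le_of_mul_le_mul_left (hmin' s hs y hy') (by linarith)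
  have hderiv := ((hasDerivAt_id s).sub_const ε).mul
    (hG.hasDerivAt_scalarCurv_surface hS (isLocalFlow_coeff hI hg hφ))
  -- The minimum may lie at the final time, so only the one-sided condition in the past direction ε
  -- − s is available: the time derivative is at most zero.
  have hle := IsLocalMinOn.hasFDerivWithinAt_nonneg (s := Set.Icc ε s) (a := s) (y := ε - s)
    (Filter.eventually_of_mem self_mem_nhdsWithin fun r hr => by
      exact hmin' r ⟨hr.1, hr.2.trans hs.2⟩ _ hy)
    hderiv.hasFDerivAt.hasFDerivWithinAt
    (sub_mem_posTangentConeAt_of_segment_subset (by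
      rw [segment_symm, segment_eq_Icc hεs.le]))
  rw [hval] at hw
  simp only [id, one_mul, ContinuousLinearMap.toSpanSingleton_apply, smul_eq_mul] at hle
  set R := scalarCurv (coeff (g s) φ) (φ z) with hR
  set Lp := laplacian (coeff (g s) φ) (scalarCurv (coeff (g s) φ)) (φ z) with hLp
  have hd0 : R + (s - ε) * (c * (Lp + R ^ 2)) ≤ 0 := by
    by_contra! hpos
    nlinarith [mul_pos (sub_pos.mpr hεs) hpos]
  have hcw : 1 + c * ((s - ε) * R) < 0 := by
    have := mul_lt_mul_of_pos_left hw hαβ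
    rw [mul_neg, mul_one_div_cancel hαβ.ne'] at this
    linarith
  have hRneg : R < 0 := by
    by_contra! h0
    have : 0 ≤ (s - ε) * R := mul_nonneg (by linarith) h0
    have : 0 < 1 / c := by positivity
    linarith
  -- The contradiction: the time derivative is this positive reaction term plus the nonnegative (s −
  -- ε)cΔR.
  have h1 : 0 < R * (1 + c * ((s - ε) * R)) := mul_pos_of_neg_of_neg hRneg hcw
  have h2 : 0 ≤ (s - ε) * (c * Lp) :=
    mul_nonneg (by linarith) (mul_nonneg hαβ.le hlap)
  nlinarith

/-- Time 0 need not belong to I, so the estimate is started at ε > 0 and ε tends to 0. -/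
theorem scalarOn_ge [CompactSpace M] (hI : IsOpen I) (hg : IsRicciYamabeFlow α β I g)
    (hαβ : 0 < α + β) {t : ℝ} (ht : 0 < t) (hsub : Set.Ioc 0 t ⊆ I) (x : M) :
    -(1 / (α + β)) ≤ t * scalarOn (g t) x := by
  have hlim : Tendsto (fun ε : ℝ => (t - ε) * scalarOn (g t) x) (𝓝[>] 0)
      (𝓝 ((t - 0) * scalarOn (g t) x)) :=
    Tendsto.mono_left (Continuous.tendsto (by fun_prop) 0) nhdsWithin_le_nhds
  rw [sub_zero] at hlim
  refine ge_of_tendsto hlim ?_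
  filter_upwards [Ioo_mem_nhdsGT ht] with ε hε
  exact scalarOn_ge_of_compact hI hg hαβ hε.2
    (fun r hr => hsub ⟨hε.1.trans_le hr.1, hr.2⟩) x

end Surface
end RicciYamabe

/-! ### Assembly of the statements chart by chart -/

theorem proposition1p5 {n : ℕ} {M : Type*} [TopologicalSpace M] [T2Space M]
    [SecondCountableTopology M] [ChartedSpace (EuclideanSpace ℝ (Fin n)) M]
    [IsManifold (𝓡 n) ∞ M] [MeasurableSpace M] [BorelSpace M]
    (I : Set ℝ) (hI : IsOpen I) (hI' : I.OrdConnected) (α β : ℝ)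
    (g : ℝ → RicciYamabe.Metric n M) (hg : IsRicciYamabeFlow α β I g) :
    -- variation of the Christoffel symbols
    (∀ φ ∈ charts n M, ∀ y ∈ φ.target, ∀ t ∈ I, ∀ i j k : Fin n,
      HasDerivAt (fun s => christoffel (coeff (g s) φ) k i j y)
        (α * ∑ l, (coeff (g t) φ y)⁻¹ k l *
            (covDeriv (coeff (g t) φ) (ricci (coeff (g t) φ)) l i j y
              - covDeriv (coeff (g t) φ) (ricci (coeff (g t) φ)) i j l y
              - covDeriv (coeff (g t) φ) (ricci (coeff (g t) φ)) j i l y)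
          - β / 2 *
            (pd (scalarCurv (coeff (g t) φ)) i y * (1 : Matrix (Fin n) (Fin n) ℝ) k j
              + pd (scalarCurv (coeff (g t) φ)) j y * (1 : Matrix (Fin n) (Fin n) ℝ) k i
              - gradUp (coeff (g t) φ) (scalarCurv (coeff (g t) φ)) k y
                * coeff (g t) φ y i j)) t) ∧
    -- variation of the scalar curvature
    (∀ φ ∈ charts n M, ∀ y ∈ φ.target, ∀ t ∈ I,
      HasDerivAt (fun s => scalarCurv (coeff (g s) φ) y)
        ((α + ((n : ℝ) - 1) * β) * laplacian (coeff (g t) φ) (scalarCurv (coeff (g t) φ)) y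
          + 2 * α * ricciNormSq (coeff (g t) φ) y
          + β * scalarCurv (coeff (g t) φ) y ^ 2) t) ∧
    -- variation of the scalar and of the Gaussian curvature of surfaces
    (∀ hn : n = 2, ∀ φ ∈ charts n M, ∀ y ∈ φ.target, ∀ t ∈ I,
      HasDerivAt (fun s => scalarCurv (coeff (g s) φ) y)
        ((α + β) * (laplacian (coeff (g t) φ) (scalarCurv (coeff (g t) φ)) y
          + scalarCurv (coeff (g t) φ) y ^ 2)) t ∧
      HasDerivAt (fun s => gaussCurv hn (coeff (g s) φ) y)
        ((α + β) * (laplacian (coeff (g t) φ) (gaussCurv hn (coeff (g t) φ)) y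
          + 2 * gaussCurv hn (coeff (g t) φ) y ^ 2)) t) ∧
    -- variation of the volume form
    (∀ φ ∈ charts n M, ∀ y ∈ φ.target, ∀ t ∈ I,
      HasDerivAt (fun s => volDensity (coeff (g s) φ) y)
        (-(α + (n : ℝ) / 2 * β) * scalarCurv (coeff (g t) φ) y
          * volDensity (coeff (g t) φ) y) t) ∧
    -- the case `2 α + n β = 0`: constant volume and variation of the scalar curvature
    (2 * α + (n : ℝ) * β = 0 →
      (∀ s ∈ I, ∀ t ∈ I, volumeMeasure (g s) = volumeMeasure (g t)) ∧
      (α ≠ 0 → ∀ φ ∈ charts n M, ∀ y ∈ φ.target, ∀ t ∈ I,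
        HasDerivAt (fun s => 1 / α * scalarCurv (coeff (g s) φ) y)
          ((2 - (n : ℝ)) / n * laplacian (coeff (g t) φ) (scalarCurv (coeff (g t) φ)) y
            + 2 * ricciNormSq (coeff (g t) φ) y
            - 2 / (n : ℝ) * scalarCurv (coeff (g t) φ) y ^ 2) t) ∧
      (n = 2 → ∀ φ ∈ charts n M, ∀ y ∈ φ.target, ∀ t ∈ I,
        HasDerivAt (fun s => scalarCurv (coeff (g s) φ) y) 0 t)) ∧
    -- lower bound for the Gaussian curvature of closed surfaces
    (∀ hn : n = 2, CompactSpace M → 1 ≤ α + β → ∀ T : ℝ, Set.Ioc 0 T ⊆ I →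
      ∀ t ∈ Set.Ioc 0 T, ∀ φ ∈ charts n M, ∀ y ∈ φ.target,
        -(1 / (2 * (α + β) * t)) ≤ gaussCurv hn (coeff (g t) φ) y) := by
  have hmem : ∀ {φ : OpenPartialHomeomorph M (Coord n)} {y : Coord n} {t : ℝ}, y ∈ φ.target →
      t ∈ I → (t, y) ∈ chartDomain hI φ := fun hy ht => ⟨ht, hy⟩
  have hscal : ∀ φ ∈ charts n M, ∀ y ∈ φ.target, ∀ t ∈ I,
      HasDerivAt (fun s => scalarCurv (coeff (g s) φ) y)
        ((α + ((n : ℝ) - 1) * β) * laplacian (coeff (g t) φ) (scalarCurv (coeff (g t) φ)) y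
          + 2 * α * ricciNormSq (coeff (g t) φ) y
          + β * scalarCurv (coeff (g t) φ) y ^ 2) t := fun φ hφ y hy t ht =>
    IsMetricOn.hasDerivAt_scalarCurv (hmem hy ht) (isLocalFlow_coeff hI hg hφ)
      (isMetricOn_coeff hI hg hφ)
  refine ⟨fun φ hφ y hy t ht i j k => IsMetricOn.hasDerivAt_christoffel (hmem hy ht)
      (isLocalFlow_coeff hI hg hφ) (isMetricOn_coeff hI hg hφ) k i j, hscal, ?_,
    fun φ hφ y hy t ht => IsMetricOn.hasDerivAt_volDensity (hmem hy ht)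
      (isLocalFlow_coeff hI hg hφ) (isMetricOn_coeff hI hg hφ) (posDef_coeff (g t) hφ hy).det_pos,
    fun hαβ => ⟨fun s hs t ht => volumeMeasure_eq hg hI hI' hαβ hs ht, ?_, ?_⟩, ?_⟩
  · intro hn φ hφ y hy t ht
    subst hn
    exact ⟨(isMetricOn_coeff hI hg hφ).hasDerivAt_scalarCurv_surface (hmem hy ht)
      (isLocalFlow_coeff hI hg hφ), (isMetricOn_coeff hI hg hφ).hasDerivAt_gaussCurv (hmem hy ht)
      (isLocalFlow_coeff hI hg hφ) rfl⟩
  · intro hα φ hφ y hy t ht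
    refine ((hscal φ hφ y hy t ht).const_mul (1 / α)).congr_deriv ?_
    -- In dimension 0 the relation 2α + nβ = 0 would force α = 0.
    have hn : (n : ℝ) ≠ 0 := by
      intro h
      rw [h, zero_mul, add_zero] at hαβ
      exact hα (by linarith)
    have hβ : β = -2 * α / n := by
      field_simp
      linarith
    rw [hβ]
    field_simp
    ring
  · intro hn φ hφ y hy t ht
    subst hn
    refine ((isMetricOn_coeff hI hg hφ).hasDerivAt_scalarCurv_surface (hmem hy ht)
      (isLocalFlow_coeff hI hg hφ)).congr_deriv ?_
    have : α + β = 0 := by push_cast at hαβ; linarith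
    rw [this, zero_mul]
  · intro hn hM hαβ T hT t ht φ hφ y hy
    subst hn
    have hpos : 0 < α + β := by linarith
    have htI : t ∈ I := hT ht
    have h1 := scalarOn_ge hI hg hpos ht.1 (fun r hr => hT ⟨hr.1, hr.2.trans ht.2⟩) (φ.symm y)
    rw [scalarOn_eq hI hg hpos.ne' hφ hy htI] at h1
    -- K = R/2, so the bound tR ≥ −1/(α + β) is divided by 2t.
    rw [(isMetricOn_coeff hI hg hφ).gaussCurv_surface (hmem hy htI)]
    have ht0 := ht.1
    have h2 : -(1 / (α + β)) / t ≤ scalarCurv (coeff (g t) φ) y := by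
      rw [div_le_iff₀ ht0]
      linarith
    have h3 : -(1 / (2 * (α + β) * t)) = -(1 / (α + β)) / t / 2 := by
      field_simp
    rw [h3]
    linarith
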